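/- **Corollary (asymptotic optimality of OSUB).** Let $G=(V,E)$ be a finite undirected graph whose vertices are the arms. For $\theta=(\theta_k)_{k\in V}\in[0,1]^V$ let the rewards $X_k(n)$ ($k\in V$, $n\ge1$) be independent, $X_k(n)\sim\mathrm{Bernoulli}(\theta_k)$. Let $\Theta_G$ be the set of $\theta\in[0,1]^V$ for which there is a unique arm $k^\star$ with maximal $\theta_k$, and every $k\ne k^\star$ is joined to $k^\star$ by a path of $G$ along which $\theta$ is strictly increasing; put $\theta^\star=\theta_{k^\star}$. A policy $\pi$ selects the arm $k(n)$ as a function of the arms selected and the rewards observed in rounds $1,\dots,n-1$. With $t_k(n)$ the number of selections of $k$ in rounds $1,\dots,n$, its regret is $R^\pi(T)=\sum_k(\theta^\star-\theta_k)\,\mathbb E[t_k(T)]$. It is uniformly good if $R^\pi(T)=o(T^a)$ for all $a>0$ and all $\theta\in\Theta_G$. Let $I(p,q)=p\log\frac pq+(1-p)\log\frac{1-p}{1-q}\in[0,\infty]$ (with $0\log 0=0$, $0\log\frac00=0$, and $p\log\frac p0=\infty$ for $p>0$), and $$c(\theta)=\sum_{k:\,(k,k^\star)\in E}\frac{\theta^\star-\theta_k}{I(\theta_k,\theta^\star)},$$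 where a term with $I(\theta_k,\theta^\star)=\infty$ is $0$. *OSUB.* Fix a constant $c>0$. Let $F(p,s,n)=\sup\{q\in[p,1]: s\,I(p,q)\le\log n+c\log\log n\}$, with $F(p,0,n)=F(1,s,n)=1$ and $F(p,s,n)=p$ if $s\ge1$ and the bound $\log n+c\log\log n$ is negative. Let $\hat\mu_k(n)$ be the empirical mean of the rewards observed from arm $k$ in rounds $1,\dots,n$ ($0$ if there are none). In round $n$, the leader $L(n)$ is an arm that maximizes $\hat\mu_k(n-1)$; let $l(n)=\#\{t\le n: L(t)=L(n)\}$ and $b_k(n)=F(\hat\mu_k(n-1),t_k(n-1),l(n))$, and let $\gamma$ be the maximal degree of $G$. OSUB selects $k(n)=L(n)$ if $l(n)-1$ is a multiple of $\gamma+1$, and otherwise an arm that maximizes $b_k(n)$ among $L(n)$ and its neighbours in $G$. Ties in both choices are broken arbitrarily, as functions of the past observations. Then, for every $c>0$ and every such tie-breaking, $\pi=\mathrm{OSUB}$ satisfies $$\limsup_{T\to\infty}\frac{R^{\pi}(T)}{\log T}\le c(\theta)\qquad\text{for every }\theta\in\Theta_G .$$ Moreover OSUB is asymptotically optimal: it is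 uniformly good, and every uniformly good policy $\pi'$ satisfies $\liminf_{T\to\infty}R^{\pi'}(T)/\log T\ge c(\theta)$ for every $\theta\in\Theta_G$. -/

import Mathlib

open Filter MeasureTheory ProbabilityTheory
open scoped ENNReal Topology

noncomputable section

namespace UnimodalBandit

/-! ### The Bernoulli bandit, decision rules and regret -/

/-- The history after `n` rounds is a list of length `n`, most recent round first; each entry
records the selected arm and the reward that was observed (`true` for `1`, `false` for `0`). -/
abbrev History (V : Type*) := List (V × Bool)

/-- A decision rule selects the next arm as a function of the arms selected in earlier rounds and
of their observed rewards. (There are finitely many histories of each length, so this is the same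
as measurability with respect to the sigma-algebra generated by the past observations.) -/
abbrev Policy (V : Type*) := History V → V

/-- The history after `n` rounds when the decision rule `π` is followed and `x (k, t)` is the reward
that arm `k` gives if it is selected in the round with index `t = 0, 1, 2, …`. -/
def play {V : Type*} (π : Policy V) (x : V × ℕ → Bool) : ℕ → History V
  | 0 => []
  | n + 1 => (π (play π x n), x (π (play π x n), n)) :: play π x n

/-- The law of the array of rewards: all `X_k(n)` are independent, and `X_k(n)` has the Bernoulli
distribution with mean `θ k`. -/
def rewardLaw {V : Type*} (θ : V → unitInterval) : Measure (V × ℕ → Bool) :=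
  Measure.infinitePi fun i : V × ℕ => bernoulliMeasure true false (θ i.1)

/-- `t_k`: the number of times that arm `k` was selected. -/
def pulls {V : Type*} [DecidableEq V] (k : V) (h : History V) : ℕ :=
  h.countP fun e => e.1 = k

/-- The largest expected reward `μ⋆`. -/
def bestMean {V : Type*} (θ : V → unitInterval) : ℝ := ⨆ k, (θ k : ℝ)

/-- The regret `R^π(T) = ∑_k (μ⋆ - μ_k) 𝔼[t_k(T)]`. -/
def regret {V : Type*} [Fintype V] [DecidableEq V] (θ : V → unitInterval) (π : Policy V)
    (T : ℕ) : ℝ :=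
  ∑ k, (bestMean θ - θ k) * ∫ x, (pulls k (play π x T) : ℝ) ∂(rewardLaw θ)

/-! ### Unimodality and the regret constant -/

/-- `Θ_G`: there is a unique best arm, and from every other arm a path of `G` leads to it along
which the expected rewards increase strictly. -/
def unimodalParams {V : Type*} (G : SimpleGraph V) : Set (V → unitInterval) :=
  {θ | ∃ kstar, (∀ k, k ≠ kstar → θ k < θ kstar) ∧
    ∀ k, k ≠ kstar → Relation.ReflTransGen (fun i j => G.Adj i j ∧ θ i < θ j) k kstar}

/-- The divergence `I(p, q) = p log (p / q) + (1 - p) log ((1 - p) / (1 - q))` between the Bernoulli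
distributions with means `p, q ∈ [0, 1]`, with the conventions `0 log (0 / q) = 0` for all `q`, and
`p log (p / 0) = ∞` for `p > 0`. -/
def klBer (p q : ℝ) : ℝ≥0∞ :=
  open Classical in
  if (q = 0 → p = 0) ∧ (q = 1 → p = 1) then
    ENNReal.ofReal (p * Real.log (p / q) + (1 - p) * Real.log ((1 - p) / (1 - q)))
  else ⊤

/-- `c(θ) = ∑ (μ⋆ - μ_k) / I(θ_k, θ⋆)`, the sum over the neighbours `k` of the best arm; a summand
with `I(θ_k, θ⋆) = ∞` is `0`. -/
def regretConst {V : Type*} [Fintype V] (G : SimpleGraph V) (θ : V → unitInterval) : ℝ≥0∞ :=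
  open Classical in
  ∑ k with ∃ kstar, (∀ j, θ j ≤ θ kstar) ∧ G.Adj k kstar,
    ENNReal.ofReal (bestMean θ - θ k) / klBer (θ k) (bestMean θ)

/-- A decision rule is uniformly good if for all `θ ∈ Θ_G` and all `a > 0` its regret is
`o(T ^ a)`. -/
def UniformlyGood {V : Type*} [Fintype V] [DecidableEq V] (G : SimpleGraph V) (π : Policy V) :
    Prop :=
  ∀ θ ∈ unimodalParams G, ∀ a : ℝ, 0 < a →
    (fun T : ℕ => regret θ π T) =o[atTop] (fun T : ℕ => (T : ℝ) ^ a)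

/-! ### The algorithm OSUB -/

/-- The empirical reward `μ̂_k`, which is `0` if `k` was never selected. -/
def empMean {V : Type*} [DecidableEq V] (k : V) (h : History V) : ℝ :=
  (h.countP fun e => e = (k, true) : ℝ) / (pulls k h : ℝ)

/-- `F(p, s, n) = sup {q ∈ [p, 1] : s I(p, q) ≤ log n + c log log n}`, with `F(p, 0, n) = 1` and
`F(1, s, n) = 1`. If the bound `log n + c log log n` is negative (which only happens for small `n`),
it is replaced by `0`, so that `F(p, s, n) = p`: the supremum of the empty subset of `[p, 1]`. -/
def klIndex (c p : ℝ) (s n : ℕ) : ℝ :=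
  open Classical in
  if s = 0 ∨ p = 1 then 1
  else sSup {q : ℝ | p ≤ q ∧ q ≤ 1 ∧
    (s : ℝ≥0∞) * klBer p q ≤ ENNReal.ofReal (Real.log n + c * Real.log (Real.log n))}

/-- `Λ h` is the leader of the round that follows the history `h`. `leads Λ h k` is the number of
rounds up to and including that one (that is, the rounds that follow `h` or one of its earlier
parts, which are the tails of `h`) in which `k` is the leader. -/
def leads {V : Type*} [DecidableEq V] (Λ : History V → V) (h : History V) (k : V) : ℕ :=
  h.tails.countP fun g => Λ g = k

/-- The index `b_k`, computed from the history `h` preceding the current round. -/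
def armIndex {V : Type*} [DecidableEq V] (c : ℝ) (Λ : History V → V) (h : History V) (k : V) : ℝ :=
  klIndex c (empMean k h) (pulls k h) (leads Λ h (Λ h))

/-- `π` is an OSUB rule on `G` with the constant `c`. The leader `Λ h` has maximal empirical reward;
it is selected if `l - 1` is a multiple of `γ + 1`, where `l` is the number of rounds in which it
has been the leader and `γ` is the maximal degree; otherwise, an arm with maximal index in the
closed neighbourhood of the leader is selected. Ties are broken arbitrarily, both in the choice of
the leader and in that of the arm. -/
def IsOSUB {V : Type*} [Fintype V] [DecidableEq V] (G : SimpleGraph V) [DecidableRel G.Adj]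
    (c : ℝ) (π : Policy V) : Prop :=
  ∃ Λ : History V → V, ∀ h : History V,
    (∀ k, empMean k h ≤ empMean (Λ h) h) ∧
    if (G.maxDegree + 1) ∣ (leads Λ h (Λ h) - 1) then π h = Λ h
    else (π h = Λ h ∨ G.Adj (π h) (Λ h)) ∧
      ∀ k, (k = Λ h ∨ G.Adj k (Λ h)) → armIndex c Λ h k ≤ armIndex c Λ h (π h)

end UnimodalBandit

end

open UnimodalBandit

set_option linter.unusedSectionVars false

noncomputable section

namespace UnimodalBandit

/-! ### The law of the history -/

section Law

variable {V : Type*} [Fintype V] [DecidableEq V] (θ : V → unitInterval) (π : Policy V)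

/-! Upper bound. All error events are indexed by counters (how often an arm has led or been
selected), not by time. Since a counter takes each value at most once along the rounds that it
counts, the expected number of bad rounds up to `T` is at most the sum over `s < T` of the
probability of the event with counter value `s`. Every such probability is `o(1/s)`, so each sum is
`o(log T)`.

The probabilities come from Ville's inequality for product supermartingales
(`measureReal_exists_weight_ge`), which is uniform in time. An empirical mean that is off by `δ`
after at least `εs` selections is exponentially rare in `s`. For `q` strictly below the mean of an
arm, its index with budget `f` ever drops below `q` with probability at most `C exp(-f)`, because
the strict gap pays for a union over all sample sizes. With `f = log n + c log log n` this is of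
order `1/(n (log n)^c)`, which is `o(1/n)` for every `c > 0`.

If a suboptimal arm `k` leads, unimodality gives a neighbour `i` with a larger mean. Outside the bad
events an unforced round led by `k` must select an arm with few samples: a well-sampled better arm
would beat `k` as leader, and a well-sampled arm that is no better than `k` has a smaller index than
`i`. There are too few such rounds to fill the time led by `k`, so `k` leads `o(log T)` rounds in
expectation (`IsLeaderRule.integral_ledRounds_isLittleO`). If the best arm leads, only its
neighbours compete, and a neighbour `k` is selected only while `t_k` times its divergence is within
the budget (`IsLeaderRule.pulls_le`); this gives `log T / I(θ_k, θ⋆)` selections up to lower order.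

Lower bound. Raising the mean of a neighbour `k` of the best arm to some `q` slightly above `θ⋆`
keeps the parameter unimodal and makes `k` the best arm. A uniformly good policy then has to select
`k` almost always, while under `θ` it selects `k` rarely. A change of measure shows that telling the
two parameters apart costs `I(θ_k, q) 𝔼[t_k(T)]`, which must be at least about `log T`; then `q`
tends to `θ⋆`. -/

instance : IsProbabilityMeasure (rewardLaw θ) := by
  unfold rewardLaw; infer_instance

theorem length_play (x : V × ℕ → Bool) (n : ℕ) : (play π x n).length = n := by
  induction n with
  | zero => rfl
  | succ n ih => simp [play, ih]

theorem play_congr {x y : V × ℕ → Bool} {n : ℕ} (h : ∀ k, ∀ m < n, x (k, m) = y (k, m)) :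
    play π x n = play π y n := by
  induction n with
  | zero => rfl
  | succ n ih =>
    have h1 := ih fun k m hm => h k m (by omega)
    simp only [play, h1, h _ n (Nat.lt_succ_self n)]

theorem measurableSet_play_eq (n : ℕ) (h : History V) :
    MeasurableSet {x : V × ℕ → Bool | play π x n = h} := by
  induction n generalizing h with
  | zero => simp [play]
  | succ n ih =>
    rcases h with _ | ⟨⟨k, b⟩, h⟩
    · simp [play]
    · have : {x : V × ℕ → Bool | play π x (n + 1) = (k, b) :: h}
          = {x | play π x n = h} ∩ {x | π h = k ∧ x (k, n) = b} := by
        ext x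
        simp only [play, List.cons.injEq, Prod.mk.injEq, Set.mem_ofPred_eq, Set.mem_inter_iff]
        constructor
        · rintro ⟨⟨h1, h2⟩, h3⟩
          subst h3; subst h1; simp_all
        · rintro ⟨h3, h1, h2⟩
          subst h3; subst h1; simp_all
      rw [this]
      refine (ih h).inter ?_
      refine (MeasurableSet.const _).inter ?_
      exact measurableSet_eq_fun (measurable_pi_apply _) measurable_const

theorem measurableSet_play_mem (n : ℕ) (S : Set (History V)) :
    MeasurableSet {x : V × ℕ → Bool | play π x n ∈ S} := by
  have : {x : V × ℕ → Bool | play π x n ∈ S} = ⋃ h ∈ S, {x | play π x n = h} := by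
    ext x; simp
  rw [this]
  exact MeasurableSet.biUnion S.to_countable fun h _ => measurableSet_play_eq π n h

theorem measurable_comp_play (F : History V → ℝ) (n : ℕ) :
    Measurable fun x : V × ℕ → Bool => F (play π x n) := fun s _ =>
  measurableSet_play_mem π n (F ⁻¹' s)

theorem exists_bound_comp_play (F : History V → ℝ) (n : ℕ) :
    ∃ C, ∀ x : V × ℕ → Bool, |F (play π x n)| ≤ C := by
  obtain ⟨C, hC⟩ := ((List.finite_length_eq (V × Bool) n).image fun h => |F h|).bddAbove
  exact ⟨C, fun x => hC ⟨_, length_play π x n, rfl⟩⟩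

theorem integrable_comp_play (F : History V → ℝ) (n : ℕ) :
    Integrable (fun x => F (play π x n)) (rewardLaw θ) := by
  obtain ⟨C, hC⟩ := exists_bound_comp_play π F n
  exact Integrable.of_bound (measurable_comp_play π F n).aestronglyMeasurable C
    (ae_of_all _ hC)

theorem integral_reward (i : V × ℕ) (g : Bool → ℝ) :
    ∫ x, g (x i) ∂(rewardLaw θ) = θ i.1 * g true + (1 - θ i.1) * g false := by
  have h := (measurePreserving_eval_infinitePi
    (fun i : V × ℕ => bernoulliMeasure true false (θ i.1)) i).map_eq
  have h2 := integral_bernoulliMeasure true false (θ i.1) g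
  rw [← h, integral_map (measurable_pi_apply i).aemeasurable
    (measurable_of_countable g).aestronglyMeasurable] at h2
  simpa [rewardLaw] using h2

/-- The first `n` rounds depend only on rewards with round index below `n`, hence are independent of
the reward `(k, n)`. The arm must be fixed here; the next lemma sums over the arm that is actually
selected. -/
theorem integral_play_mul_reward (F : History V → ℝ) (n : ℕ) (k : V) (g : Bool → ℝ) :
    ∫ x, F (play π x n) * g (x (k, n)) ∂(rewardLaw θ)
      = (∫ x, F (play π x n) ∂(rewardLaw θ)) * (θ k * g true + (1 - θ k) * g false) := by
  have hind : iIndepFun (fun (i : V × ℕ) (x : V × ℕ → Bool) => x i) (rewardLaw θ) :=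
    iIndepFun_infinitePi (X := fun _ => id) fun _ => measurable_id
  have h := hind.indepFun_finset (Finset.univ ×ˢ Finset.range n) {(k, n)} (by simp)
    fun i => measurable_pi_apply i
  -- The history is rewritten as a function of finitely many coordinates; the filler `false`
  -- elsewhere is never read.
  let S : Finset (V × ℕ) := Finset.univ ×ˢ Finset.range n
  let φ : (S → Bool) → ℝ := fun y =>
    F (play π (fun i => if hi : i ∈ S then y ⟨i, hi⟩ else false) n)
  let ψ : (({(k, n)} : Finset (V × ℕ)) → Bool) → ℝ := fun y => g (y ⟨(k, n), by simp⟩)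
  have h2 := h.comp (φ := φ) (ψ := ψ) (measurable_of_countable _) (measurable_of_countable _)
  have e1 : (φ ∘ fun (x : V × ℕ → Bool) (i : S) => x i) = fun x => F (play π x n) := by
    funext x
    simp only [φ, Function.comp]
    congr 1
    refine play_congr π fun j m hm => ?_
    simp [S, hm]
  have e2 : (ψ ∘ fun (x : V × ℕ → Bool) (i : ({(k, n)} : Finset (V × ℕ))) => x i)
      = fun x => g (x (k, n)) := rfl
  rw [← integral_reward θ (k, n) g]
  refine IndepFun.integral_fun_mul_eq_mul_integral ?_
    (measurable_comp_play π F n).aestronglyMeasurable ?_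
  · rw [← e1, ← e2]; exact h2
  · exact ((measurable_of_countable g).comp (measurable_pi_apply _)).aestronglyMeasurable

/-- The conditional expectation of `F`, evaluated one round later, given the history `h`. -/
def nextMean (F : History V → ℝ) (h : History V) : ℝ :=
  θ (π h) * F ((π h, true) :: h) + (1 - θ (π h)) * F ((π h, false) :: h)

theorem integral_play_succ (F : History V → ℝ) (n : ℕ) :
    ∫ x, F (play π x (n + 1)) ∂(rewardLaw θ)
      = ∫ x, nextMean θ π F (play π x n) ∂(rewardLaw θ) := by
  let U : V → Bool → History V → ℝ := fun k b h => if π h = k then F ((k, b) :: h) else 0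
  let g : Bool → Bool → ℝ := fun b b' => if b' = b then 1 else 0
  have e1 : ∀ x : V × ℕ → Bool, F (play π x (n + 1))
      = ∑ k, ∑ b, U k b (play π x n) * g b (x (k, n)) := by
    intro x
    rw [Finset.sum_eq_single (π (play π x n))]
    · rw [Finset.sum_eq_single (x (π (play π x n), n))]
      · simp [U, g, play]
      · intro b _ hb; simp [g, hb.symm]
      · simp
    · intro k _ hk; simp [U, hk.symm]
    · simp
  have hint : ∀ k b, Integrable (fun x => U k b (play π x n) * g b (x (k, n))) (rewardLaw θ) := by
    intro k b
    refine (integrable_comp_play θ π (U k b) n).mul_bdd (c := 1) ?_ (ae_of_all _ fun x => ?_)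
    · exact ((measurable_of_countable (g b)).comp (measurable_pi_apply _)).aestronglyMeasurable
    · simp only [g]; split_ifs <;> simp
  have e2 : ∀ x : V × ℕ → Bool, nextMean θ π F (play π x n)
      = ∑ k, ∑ b, U k b (play π x n) * (θ k * g b true + (1 - θ k) * g b false) := by
    intro x
    rw [Finset.sum_eq_single (π (play π x n))]
    · simp [U, g, nextMean]; ring
    · intro k _ hk; simp [U, hk.symm]
    · simp
  simp_rw [e1, e2]
  rw [integral_finsetSum _ fun k _ => integrable_finsetSum _ fun b _ => hint k b,
    integral_finsetSum _ fun k _ => integrable_finsetSum _ fun b _ =>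
      (integrable_comp_play θ π (U k b) n).mul_const _]
  refine Finset.sum_congr rfl fun k _ => ?_
  rw [integral_finsetSum _ fun b _ => hint k b, integral_finsetSum _ fun b _ =>
      (integrable_comp_play θ π (U k b) n).mul_const _]
  refine Finset.sum_congr rfl fun b _ => ?_
  rw [integral_play_mul_reward, integral_mul_const]

theorem integral_play_mono {F G : History V → ℝ} (h : ∀ g, F g ≤ G g) (n : ℕ) :
    ∫ x, F (play π x n) ∂(rewardLaw θ) ≤ ∫ x, G (play π x n) ∂(rewardLaw θ) :=
  integral_mono (integrable_comp_play θ π F n) (integrable_comp_play θ π G n) fun _ => h _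

theorem integral_play_le_of_nextMean_le {F : History V → ℝ} (h : ∀ g, nextMean θ π F g ≤ F g)
    (n : ℕ) : ∫ x, F (play π x n) ∂(rewardLaw θ) ≤ F [] := by
  induction n with
  | zero => simp [play]
  | succ n ih =>
    rw [integral_play_succ]
    exact (integral_play_mono θ π h n).trans ih

/-! ### A maximal inequality -/

/-- The likelihood-type weight of a history: the product of `w b` over all rewards `b` of `k`. -/
def weight (w : Bool → ℝ) (k : V) : History V → ℝ
  | [] => 1
  | e :: h => (if e.1 = k then w e.2 else 1) * weight w k h

/-- The number of successes of arm `k`. -/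
def wins (k : V) (h : History V) : ℕ := h.countP fun e => e = (k, true)

theorem wins_cons (k : V) (e : V × Bool) (h : History V) :
    wins k (e :: h) = wins k h + if e.1 = k ∧ e.2 = true then 1 else 0 := by
  rcases e with ⟨j, b⟩
  simp [wins, List.countP_cons]

theorem pulls_cons (k : V) (e : V × Bool) (h : History V) :
    pulls k (e :: h) = pulls k h + if e.1 = k then 1 else 0 := by
  simp [pulls, List.countP_cons]

theorem wins_le_pulls (k : V) (h : History V) : wins k h ≤ pulls k h := by
  induction h with
  | nil => simp [wins, pulls]
  | cons e h ih =>
    rw [wins_cons, pulls_cons]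
    split_ifs <;> first | omega | simp_all

theorem empMean_eq (k : V) (h : History V) : empMean k h = (wins k h : ℝ) / pulls k h := rfl

theorem weight_nonneg {w : Bool → ℝ} (hw : ∀ b, 0 ≤ w b) (k : V) (h : History V) :
    0 ≤ weight w k h := by
  induction h with
  | nil => simp [weight]
  | cons e h ih =>
    rw [weight]
    split_ifs
    · exact mul_nonneg (hw _) ih
    · simpa using ih

theorem weight_eq (w : Bool → ℝ) (k : V) (h : History V) :
    weight w k h = w true ^ wins k h * w false ^ (pulls k h - wins k h) := by
  induction h with
  | nil => simp [weight, wins, pulls]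
  | cons e h ih =>
    have hle := wins_le_pulls k h
    rcases e with ⟨j, b⟩
    rw [weight, wins_cons, pulls_cons, ih]
    by_cases hj : j = k
    · cases b
      · have : pulls k h + 1 - wins k h = (pulls k h - wins k h) + 1 := by omega
        simp [hj, this, pow_succ]; ring
      · simp [hj]; ring
    · simp [hj]

theorem nextMean_weight_le {w : Bool → ℝ} (hw : ∀ b, 0 ≤ w b) (k : V)
    (h1 : θ k * w true + (1 - θ k) * w false ≤ 1) (h : History V) :
    nextMean θ π (weight w k) h ≤ weight w k h := by
  simp only [nextMean, weight]
  by_cases hk : π h = k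
  · simp only [hk, if_true]
    have := weight_nonneg hw k h
    nlinarith
  · simp only [hk, if_false]; linarith

/-- Continuity from below, which removes the finite horizon from Ville's inequality. -/
theorem measureReal_exists_le_of_forall {p : ℕ → Set (V × ℕ → Bool)} {C : ℝ}
    (hC : 0 ≤ C) (h : ∀ N, (rewardLaw θ).real (⋃ n ≤ N, p n) ≤ C) :
    (rewardLaw θ).real (⋃ n, p n) ≤ C := by
  have e : (⋃ n, p n) = ⋃ N, ⋃ n ≤ N, p n := by
    ext x; simp only [Set.mem_iUnion]
    exact ⟨fun ⟨n, hn⟩ => ⟨n, n, le_rfl, hn⟩, fun ⟨_, n, _, hn⟩ => ⟨n, hn⟩⟩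
  have hm : Monotone fun N => ⋃ n ≤ N, p n := by
    intro a b hab
    exact Set.biUnion_subset_biUnion_left fun n hn => le_trans hn hab
  rw [measureReal_def, e, hm.measure_iUnion]
  refine ENNReal.toReal_le_of_le_ofReal hC (iSup_le fun N => ?_)
  rw [ENNReal.le_ofReal_iff_toReal_le (measure_ne_top _ _) hC]
  exact h N

theorem mem_tails_play_iff (x : V × ℕ → Bool) (N : ℕ) (g : History V) :
    g ∈ (play π x N).tails ↔ ∃ n ≤ N, g = play π x n := by
  induction N with
  | zero => simp [play]
  | succ N ih =>
    rw [play, List.tails_cons, List.mem_cons, ih]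
    constructor
    · rintro (h | ⟨n, hn, h⟩)
      · exact ⟨N + 1, le_rfl, h⟩
      · exact ⟨n, by omega, h⟩
    · rintro ⟨n, hn, h⟩
      rcases Nat.lt_or_ge n (N + 1) with h1 | h1
      · exact Or.inr ⟨n, by omega, h⟩
      · obtain rfl : n = N + 1 := by omega
        exact Or.inl h

/-- Ville's inequality for the nonnegative supermartingale `weight w k`. -/
theorem measureReal_exists_weight_ge {w : Bool → ℝ} (hw : ∀ b, 0 ≤ w b) (k : V)
    (h1 : θ k * w true + (1 - θ k) * w false ≤ 1) {a : ℝ} (ha : 0 < a) :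
    (rewardLaw θ).real {x | ∃ n, a ≤ weight w k (play π x n)} ≤ 1 / a := by
  classical
  have e : {x : V × ℕ → Bool | ∃ n, a ≤ weight w k (play π x n)}
      = ⋃ n, {x | a ≤ weight w k (play π x n)} := by ext; simp
  rw [e]
  refine measureReal_exists_le_of_forall θ (by positivity) fun N => ?_
  let hit : History V → Prop := fun h => ∃ g ∈ h.tails, a ≤ weight w k g
  -- The process is frozen at the value `a` from the first passage on. Since the weight is at least
  -- `a` at that passage, the replacement only lowers it, so `U` is still a supermartingale. Passage
  -- can be read off the history because earlier histories are its tails.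
  let U : History V → ℝ := fun h => if hit h then a else weight w k h
  have hU : ∀ h, nextMean θ π U h ≤ U h := by
    intro h
    by_cases hh : hit h
    · have : ∀ b, U ((π h, b) :: h) = a := by
        intro b
        obtain ⟨g, hg, hg'⟩ := hh
        exact if_pos ⟨g, by simp only [List.tails_cons, List.mem_cons]; exact Or.inr hg, hg'⟩
      simp only [nextMean, this, U, hh, if_true]
      linarith
    · have : ∀ b, U ((π h, b) :: h) ≤ weight w k ((π h, b) :: h) := by
        intro b
        by_cases hb : hit ((π h, b) :: h)
        · simp only [U, hb, if_true]
          obtain ⟨g, hg, hg'⟩ := hb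
          rw [List.tails_cons, List.mem_cons] at hg
          rcases hg with rfl | hg
          · exact hg'
          · exact absurd ⟨g, hg, hg'⟩ hh
        · simp [U, hb]
      have h3 := nextMean_weight_le θ π hw k h1 h
      have : nextMean θ π U h ≤ nextMean θ π (weight w k) h :=
        add_le_add (mul_le_mul_of_nonneg_left (this true) (θ (π h)).2.1)
          (mul_le_mul_of_nonneg_left (this false) (sub_nonneg.2 (θ (π h)).2.2))
      simp only [U, hh, if_false] at this ⊢
      linarith
  have h0 : U [] ≤ 1 := by
    by_cases hh : hit []
    · simp only [U, hh, if_true]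
      simpa [hit, weight] using hh
    · simp [U, hh, weight]
  have h2 := integral_play_le_of_nextMean_le θ π hU N
  have hset : (⋃ n ≤ N, {x : V × ℕ → Bool | a ≤ weight w k (play π x n)})
      = {x | play π x N ∈ {h | hit h}} := by
    ext x
    simp only [Set.mem_iUnion, Set.mem_ofPred_eq, hit, mem_tails_play_iff]
    constructor
    · rintro ⟨n, hn, h⟩; exact ⟨_, ⟨n, hn, rfl⟩, h⟩
    · rintro ⟨_, ⟨n, hn, rfl⟩, h⟩; exact ⟨n, hn, h⟩
  have hms := measurableSet_play_mem π N {h : History V | hit h}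
  rw [hset]
  have h4 : a * (rewardLaw θ).real {x | play π x N ∈ {h | hit h}}
      ≤ ∫ x, U (play π x N) ∂(rewardLaw θ) := by
    rw [mul_comm, ← smul_eq_mul, ← integral_indicator_const _ hms]
    refine integral_mono ((integrable_const a).indicator hms) (integrable_comp_play θ π U N) ?_
    intro x
    by_cases hx : hit (play π x N)
    · simp [Set.indicator, U, hx]
    · simp [Set.indicator, U, hx, weight_nonneg hw]
  rw [le_div_iff₀ ha]
  linarith

end Law

/-! ### The Bernoulli divergence -/

/-- The Bernoulli divergence as a real number, for `q` strictly between `0` and `1`. -/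
def klReal (p q : ℝ) : ℝ :=
  p * Real.log p + (1 - p) * Real.log (1 - p) - p * Real.log q - (1 - p) * Real.log (1 - q)

/-- The difference of the two sides is `(q - p) (log (r / q) + log ((1 - q) / (1 - r)))`. Both
monotonicity properties of the divergence follow from it, as does the extra exponential factor in
the index deviation bound. -/
theorem klReal_three_point {p q r : ℝ} (hpq : p ≤ q) (hqr : q ≤ r) (hq : 0 < q) (hr : r < 1) :
    klReal p q + klReal q r ≤ klReal p r := by
  have h1 : Real.log q ≤ Real.log r := Real.log_le_log hq hqr
  have h2 : Real.log (1 - r) ≤ Real.log (1 - q) := Real.log_le_log (by linarith) (by linarith)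
  unfold klReal
  nlinarith

/-- This is `log x ≤ x - 1` at `x = b / a`. With `a = √p`, `b = √q` and the same for the
complements, the sum bounds the divergence below by the squared Hellinger distance, and so by `(q -
p) ^ 2 / 2`. -/
theorem sq_mul_log_sub_log_ge {a b : ℝ} (ha : 0 ≤ a) (hb : 0 < b) :
    2 * a ^ 2 - 2 * a * b ≤ a ^ 2 * Real.log (a ^ 2) - a ^ 2 * Real.log (b ^ 2) := by
  rcases ha.eq_or_lt with rfl | ha
  · simp
  · have h := Real.log_le_sub_one_of_pos (div_pos hb ha)
    rw [Real.log_div hb.ne' ha.ne'] at h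
    rw [Real.log_pow, Real.log_pow]
    have h2 : a ^ 2 * (Real.log b - Real.log a) ≤ a ^ 2 * (b / a - 1) := by gcongr
    have h3 : a ^ 2 * (b / a - 1) = a * b - a ^ 2 := by field_simp
    push_cast
    nlinarith

theorem sq_sub_sq_le {a b : ℝ} (ha : 0 ≤ a) (hb : 0 ≤ b) (ha1 : a ^ 2 ≤ 1) (hb1 : b ^ 2 ≤ 1) :
    (a ^ 2 - b ^ 2) ^ 2 / 4 ≤ (a - b) ^ 2 := by
  have h1 : a ≤ 1 := by nlinarith
  have h2 : b ≤ 1 := by nlinarith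
  have h3 : (a ^ 2 - b ^ 2) ^ 2 = (a - b) ^ 2 * (a + b) ^ 2 := by ring
  have h4 : (a + b) ^ 2 ≤ 4 := by nlinarith
  nlinarith [sq_nonneg (a - b)]

/-- Pinsker's inequality with a non-optimal constant. -/
theorem sq_le_klReal {p q : ℝ} (hp : 0 ≤ p) (hp1 : p ≤ 1) (hq : 0 < q) (hq1 : q < 1) :
    (q - p) ^ 2 / 2 ≤ klReal p q := by
  have hp' : 0 ≤ 1 - p := by linarith
  have hq' : 0 < 1 - q := by linarith
  have h1 := sq_mul_log_sub_log_ge (Real.sqrt_nonneg p) (Real.sqrt_pos.2 hq)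
  have h2 := sq_mul_log_sub_log_ge (Real.sqrt_nonneg (1 - p)) (Real.sqrt_pos.2 hq')
  have h3 := sq_sub_sq_le (Real.sqrt_nonneg p) (Real.sqrt_nonneg q)
  have h4 := sq_sub_sq_le (Real.sqrt_nonneg (1 - p)) (Real.sqrt_nonneg (1 - q))
  have e1 := Real.sq_sqrt hp
  have e2 := Real.sq_sqrt hp'
  have e3 := Real.sq_sqrt hq.le
  have e4 := Real.sq_sqrt hq'.le
  rw [e1, e3] at h1 h3
  rw [e2, e4] at h2 h4
  have h3 := h3 hp1 hq1.le
  have h4 := h4 (by linarith) (by linarith)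
  unfold klReal
  nlinarith

theorem klReal_nonneg {p q : ℝ} (hp : 0 ≤ p) (hp1 : p ≤ 1) (hq : 0 < q) (hq1 : q < 1) :
    0 ≤ klReal p q := (by positivity : (0 : ℝ) ≤ (q - p) ^ 2 / 2).trans (sq_le_klReal hp hp1 hq hq1)

theorem klReal_pos {p q : ℝ} (hp : 0 ≤ p) (hp1 : p ≤ 1) (hq : 0 < q) (hq1 : q < 1) (h : p ≠ q) :
    0 < klReal p q := by
  refine lt_of_lt_of_le ?_ (sq_le_klReal hp hp1 hq hq1)
  have := sq_pos_of_ne_zero (sub_ne_zero.2 h.symm)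
  positivity

theorem klReal_mono_right {p q r : ℝ} (hp : p ≤ q) (hq : 0 < q) (hqr : q ≤ r) (hr : r < 1) :
    klReal p q ≤ klReal p r := by
  have := klReal_three_point hp hqr hq hr
  have := klReal_nonneg hq.le (by linarith) (by linarith : 0 < r) hr
  linarith

theorem klReal_anti_left {p q r : ℝ} (hp : 0 ≤ p) (hpq : p ≤ q) (hq : 0 < q) (hqr : q ≤ r)
    (hr : r < 1) : klReal q r ≤ klReal p r := by
  have := klReal_three_point hpq hqr hq hr
  have := klReal_nonneg hp (by linarith) hq (by linarith)
  linarith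

theorem klReal_eq {p q : ℝ} (hq : 0 < q) (hq1 : q < 1) :
    p * Real.log (p / q) + (1 - p) * Real.log ((1 - p) / (1 - q)) = klReal p q := by
  have h1 : p * Real.log (p / q) = p * Real.log p - p * Real.log q := by
    rcases eq_or_ne p 0 with rfl | hp
    · simp
    · rw [Real.log_div hp hq.ne']; ring
  have h2 : (1 - p) * Real.log ((1 - p) / (1 - q))
      = (1 - p) * Real.log (1 - p) - (1 - p) * Real.log (1 - q) := by
    rcases eq_or_ne (1 - p) 0 with hp | hp
    · simp [hp]
    · rw [Real.log_div hp (by linarith)]; ring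
  rw [h1, h2, klReal]; ring

theorem klBer_eq {p q : ℝ} (hq : 0 < q) (hq1 : q < 1) :
    klBer p q = ENNReal.ofReal (klReal p q) := by
  rw [klBer, if_pos ⟨fun h => absurd h hq.ne', fun h => absurd h hq1.ne⟩, klReal_eq hq hq1]

theorem klBer_one {p : ℝ} (hp : p ≠ 1) : klBer p 1 = ⊤ := by
  rw [klBer, if_neg]; simp [hp]

theorem klBer_self (p : ℝ) : klBer p p = 0 := by
  rw [klBer, if_pos ⟨id, id⟩]
  have h : ∀ a : ℝ, a * Real.log (a / a) = 0 := fun a => by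
    rcases eq_or_ne a 0 with rfl | ha
    · simp
    · simp [div_self ha]
  rw [h, h]
  simp

/-- The exploration bound of the index. -/
def budget (c : ℝ) (n : ℕ) : ℝ := Real.log n + c * Real.log (Real.log n)

theorem klIndex_le_one (c : ℝ) {p : ℝ} (s n : ℕ) : klIndex c p s n ≤ 1 := by
  rw [klIndex]
  split_ifs
  · exact le_rfl
  · exact Real.sSup_le (fun q hq => hq.2.1) zero_le_one

theorem le_klIndex_of_mem {c p q : ℝ} {s n : ℕ} (hpq : p ≤ q) (hq1 : q ≤ 1)
    (h : (s : ℝ≥0∞) * klBer p q ≤ ENNReal.ofReal (budget c n)) : q ≤ klIndex c p s n := by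
  rw [klIndex]
  split_ifs
  · exact hq1
  · exact le_csSup ⟨1, fun q hq => hq.2.1⟩ ⟨hpq, hq1, h⟩

/-- The point `q = p` costs nothing and stays feasible for a negative budget, which `ENNReal.ofReal`
truncates to `0`. -/
theorem le_klIndex {c p : ℝ} (hp1 : p ≤ 1) (s n : ℕ) : p ≤ klIndex c p s n :=
  le_klIndex_of_mem le_rfl hp1 (by simp [klBer_self])

theorem natCast_mul_klBer {p q : ℝ} (hq : 0 < q) (hq1 : q < 1) (s : ℕ) :
    (s : ℝ≥0∞) * klBer p q = ENNReal.ofReal (s * klReal p q) := by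
  rw [klBer_eq hq hq1, ENNReal.ofReal_mul (by positivity), ENNReal.ofReal_natCast]

/-- Some feasible `q` exceeds `y`, and the divergence from `p` increases to the right of `p`. The
value `q = 1` is excluded by its infinite divergence. -/
theorem mul_klReal_le_of_lt_klIndex {c p y : ℝ} {s n : ℕ} (hy : 0 < y) (hy1 : y < 1)
    (hpy : p ≤ y) (hs : s ≠ 0) (h : y < klIndex c p s n) :
    s * klReal p y ≤ max (budget c n) 0 := by
  have hp1 : p ≠ 1 := by linarith
  rw [klIndex, if_neg (by tauto)] at h
  have hne : {q : ℝ | p ≤ q ∧ q ≤ 1 ∧ (s : ℝ≥0∞) * klBer p q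
      ≤ ENNReal.ofReal (Real.log n + c * Real.log (Real.log n))}.Nonempty :=
    ⟨p, le_rfl, by linarith, by simp [klBer_self]⟩
  obtain ⟨q, ⟨-, hq1, hq⟩, hyq⟩ := exists_lt_of_lt_csSup hne h
  rcases hq1.eq_or_lt with rfl | hq1
  · rw [klBer_one hp1, ENNReal.mul_top (by exact_mod_cast hs)] at hq
    exact absurd hq (by simp)
  · rw [natCast_mul_klBer (hy.trans hyq) hq1] at hq
    have h1 : s * klReal p q ≤ max (budget c n) 0 := by
      have h2 := ENNReal.toReal_mono ENNReal.ofReal_ne_top hq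
      rw [ENNReal.toReal_ofReal', ENNReal.toReal_ofReal'] at h2
      exact (le_max_left _ _).trans h2
    exact le_trans (by gcongr; exact klReal_mono_right hpy hy hyq.le hq1) h1

theorem klIndex_le_add {c p δ : ℝ} {s n : ℕ} (hp : 0 ≤ p) (hδ : 0 < δ) (hs : s ≠ 0)
    (h : max (budget c n) 0 < s * (δ ^ 2 / 2)) : klIndex c p s n ≤ p + δ := by
  by_contra! hlt
  have hle := klIndex_le_one c (p := p) s n
  have h1 := mul_klReal_le_of_lt_klIndex (by linarith) (by linarith) (by linarith) hs hlt
  have h2 := sq_le_klReal hp (by linarith) (by linarith : 0 < p + δ) (by linarith)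
  have h3 : (s : ℝ) * (δ ^ 2 / 2) ≤ s * klReal p (p + δ) := by
    gcongr; simpa using h2
  linarith

theorem budget_lt_of_klIndex_lt {c p q : ℝ} {s n : ℕ} (hp1 : p ≤ 1) (hq : 0 < q) (hq1 : q < 1)
    (h : klIndex c p s n < q) : s ≠ 0 ∧ p < q ∧ budget c n < s * klReal p q := by
  have hpq : p < q := (le_klIndex hp1 s n).trans_lt h
  refine ⟨?_, hpq, ?_⟩
  · rintro rfl
    rw [klIndex, if_pos (Or.inl rfl)] at h
    linarith
  · by_contra! hle
    refine absurd (le_klIndex_of_mem (c := c) (s := s) (n := n) hpq.le hq1.le ?_) (not_le.2 h)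
    rw [natCast_mul_klBer hq hq1]
    exact ENNReal.ofReal_le_ofReal hle

/-! ### Deviations of the empirical means -/

section Deviations

variable {V : Type*} [Fintype V] [DecidableEq V] (θ : V → unitInterval) (π : Policy V)

/-- Ville's inequality for the exponential weight: `exp y ≤ 1 + y + y ^ 2` for `|y| ≤ 1` bounds the
moment generating function of a centred reward by `1 + l ^ 2 ≤ exp (l ^ 2)`. -/
theorem measureReal_exists_exponent_ge (k : V) {l : ℝ} (hl : |l| ≤ 1) (a : ℝ) :
    (rewardLaw θ).real {x | ∃ n, a ≤ l * (wins k (play π x n) - θ k * pulls k (play π x n))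
      - l ^ 2 * pulls k (play π x n)} ≤ Real.exp (-a) := by
  let w : Bool → ℝ := fun b => Real.exp (l * ((if b then 1 else 0) - θ k) - l ^ 2)
  have hθ0 := (θ k).2.1
  have hθ1 := (θ k).2.2
  have hexp : ∀ y : ℝ, |y| ≤ 1 → Real.exp (l * y) ≤ 1 + l * y + l ^ 2 := by
    intro y hy
    have h1 : |l * y| ≤ 1 := by rw [abs_mul]; nlinarith [abs_nonneg l, abs_nonneg y]
    have h2 := (abs_le.1 (Real.abs_exp_sub_one_sub_id_le h1)).2
    have h3 : (l * y) ^ 2 ≤ l ^ 2 := by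
      rw [mul_pow]
      have : y ^ 2 ≤ 1 := by rw [← sq_abs]; nlinarith [abs_nonneg y]
      nlinarith [sq_nonneg l]
    linarith
  have hw : θ k * w true + (1 - θ k) * w false ≤ 1 := by
    have h1 := hexp (1 - θ k) (abs_le.2 ⟨by linarith, by linarith⟩)
    have h2 := hexp (0 - θ k) (abs_le.2 ⟨by linarith, by linarith⟩)
    have e : ∀ b, w b = Real.exp (l * ((if b then 1 else 0) - θ k)) * Real.exp (-l ^ 2) := by
      intro b; simp only [w]; rw [← Real.exp_add]; ring_nf
    rw [e, e]
    have h3 : θ k * Real.exp (l * (1 - θ k)) + (1 - θ k) * Real.exp (l * (0 - θ k))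
        ≤ 1 + l ^ 2 := by nlinarith
    have h4 : 1 + l ^ 2 ≤ Real.exp (l ^ 2) := by linarith [Real.add_one_le_exp (l ^ 2)]
    have h5 : Real.exp (l ^ 2) * Real.exp (-l ^ 2) = 1 := by rw [← Real.exp_add]; simp
    have h6 := Real.exp_pos (-l ^ 2)
    simp only [if_true, Bool.false_eq_true, if_false]
    calc _ = (θ k * Real.exp (l * (1 - θ k)) + (1 - θ k) * Real.exp (l * (0 - θ k)))
          * Real.exp (-l ^ 2) := by ring
      _ ≤ Real.exp (l ^ 2) * Real.exp (-l ^ 2) := by gcongr; linarith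
      _ = 1 := h5
  have h := measureReal_exists_weight_ge θ π (w := w) (fun b => (Real.exp_pos _).le) k hw
    (Real.exp_pos a)
  rw [one_div, ← Real.exp_neg] at h
  convert! h using 5 with x
  funext n
  rw [weight_eq, ← Real.exp_nat_mul, ← Real.exp_nat_mul, ← Real.exp_add, Real.exp_le_exp,
    Nat.cast_sub (wins_le_pulls k _)]
  simp only [if_true, Bool.false_eq_true, if_false]
  ring_nf

/-- At some time when arm `k` has been selected at least `m` times, its empirical mean is at
distance at least `δ` from its expected reward. -/
def deviation (k : V) (δ m : ℝ) : Set (V × ℕ → Bool) :=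
  {x | ∃ n, m ≤ pulls k (play π x n) ∧
    δ * pulls k (play π x n) ≤ |(wins k (play π x n) : ℝ) - θ k * pulls k (play π x n)|}

/-- At some time, the index of arm `k` with exploration bound `f` is less than `q`. -/
def indexDeviation (k : V) (q f : ℝ) : Set (V × ℕ → Bool) :=
  {x | ∃ n, pulls k (play π x n) ≠ 0 ∧ empMean k (play π x n) ≤ q ∧
    f ≤ pulls k (play π x n) * klReal (empMean k (play π x n)) q}

theorem exists_measureReal_deviation_le (k : V) {δ : ℝ} (hδ : 0 < δ) :
    ∃ κ > 0, ∀ m : ℝ, (rewardLaw θ).real (deviation θ π k δ m) ≤ 2 * Real.exp (-(κ * m)) := by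
  -- Any `l ≤ 1` with `0 < l < δ` makes the rate `l * δ - l ^ 2` positive; `l` and `-l` handle the
  -- two signs of the deviation.
  set l : ℝ := min δ 1 / 2 with hl
  have hl0 : 0 < l := by positivity
  have hlδ : l ≤ δ / 2 := by rw [hl]; gcongr; exact min_le_left _ _
  have hl1 : |l| ≤ 1 := by
    rw [abs_of_pos hl0]
    have := min_le_right δ 1
    linarith
  have hκ : 0 < l * δ - l ^ 2 := by nlinarith
  refine ⟨_, hκ, fun m => ?_⟩
  have h1 := measureReal_exists_exponent_ge θ π k hl1 ((l * δ - l ^ 2) * m)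
  have h2 := measureReal_exists_exponent_ge θ π k (l := -l) (by rwa [abs_neg])
    ((l * δ - l ^ 2) * m)
  refine (measureReal_mono ?_).trans ((measureReal_union_le _ _).trans (add_le_add h1 h2)) |>.trans
    (by rw [two_mul])
  rintro x ⟨n, hm, hd⟩
  have h3 : (l * δ - l ^ 2) * m ≤ (l * δ - l ^ 2) * pulls k (play π x n) := by gcongr
  rcases le_abs.1 hd with h | h
  · exact Or.inl ⟨n, by nlinarith⟩
  · exact Or.inr ⟨n, by nlinarith⟩

theorem pow_mul_pow_eq_exp_klReal {t s : ℕ} (ht : t ≠ 0) (hst : s ≤ t) {r : ℝ} (hr : 0 < r)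
    (hr1 : r < 1) : ((s / t : ℝ) / r) ^ s * ((1 - s / t) / (1 - r)) ^ (t - s)
      = Real.exp (t * klReal (s / t) r) := by
  have ht' : (t : ℝ) ≠ 0 := by exact_mod_cast ht
  have key : ∀ (m : ℕ) (y z : ℝ), 0 ≤ y → 0 < z → (y = 0 → m = 0) →
      (y / z) ^ m = Real.exp (m * (Real.log y - Real.log z)) := by
    intro m y z hy hz h
    rcases hy.eq_or_lt with rfl | hy
    · simp [h rfl]
    · rw [← Real.log_div hy.ne' hz.ne', Real.exp_nat_mul, Real.exp_log (by positivity)]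
  have hs1 : (s / t : ℝ) ≤ 1 := div_le_one_of_le₀ (by exact_mod_cast hst) (by positivity)
  rw [key s _ _ (by positivity) hr, key (t - s) _ _ (by linarith) (by linarith), ← Real.exp_add,
    Nat.cast_sub hst]
  · congr 1
    rw [klReal]
    field_simp
    ring
  · intro h
    rw [sub_eq_zero, eq_comm, div_eq_one_iff_eq ht'] at h
    have : s = t := by exact_mod_cast h
    omega
  · intro h
    simpa [ht'] using h

/-- The weight is the likelihood ratio of mean `s / t` against mean `r`. It has mean one under `r`,
and at most one under `θ k > r`, because a success multiplies it by at most `1` and a failure by at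
least `1`. On the event it equals `exp (t * klReal (s / t) r)`, and the three-point inequality
splits off `exp (t * klReal q r)`. -/
theorem measureReal_exists_counts_le (k : V) {q r : ℝ} (hq : 0 < q) (hqr : q < r) (hr : r < θ k)
    {t s : ℕ} (ht : t ≠ 0) (hst : s ≤ t) (hsq : (s / t : ℝ) ≤ q) {f : ℝ}
    (hf : f ≤ t * klReal (s / t) q) :
    (rewardLaw θ).real {x | ∃ n, pulls k (play π x n) = t ∧ wins k (play π x n) = s}
      ≤ Real.exp (-f) * Real.exp (-klReal q r * t) := by
  have hθ1 := (θ k).2.2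
  have hr1 : r < 1 := hr.trans_le hθ1
  have hp0 : (0 : ℝ) ≤ s / t := by positivity
  have hle : (s / t : ℝ) / r ≤ 1 := div_le_one_of_le₀ (by linarith) (by linarith)
  have hge : 1 ≤ (1 - (s / t : ℝ)) / (1 - r) := by rw [one_le_div] <;> linarith
  let w : Bool → ℝ := fun b => if b then (s / t : ℝ) / r else (1 - s / t) / (1 - r)
  have hw0 : ∀ b, 0 ≤ w b := by
    intro b
    cases b
    · simp only [w, Bool.false_eq_true, if_false]; linarith
    · simp only [w, if_true]; exact div_nonneg hp0 (by linarith)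
  have hw : θ k * w true + (1 - θ k) * w false ≤ 1 := by
    have e : r * ((s / t : ℝ) / r) + (1 - r) * ((1 - s / t) / (1 - r)) = 1 := by
      rw [mul_div_cancel₀ _ (by linarith), mul_div_cancel₀ _ (by linarith)]; ring
    simp only [w, if_true, Bool.false_eq_true, if_false]
    nlinarith
  have h := measureReal_exists_weight_ge θ π hw0 k hw (Real.exp_pos (f + klReal q r * t))
  rw [one_div, ← Real.exp_neg] at h
  rw [← Real.exp_add, show -f + -klReal q r * t = -(f + klReal q r * t) by ring]
  refine (measureReal_mono ?_).trans h
  rintro x ⟨n, hn, hn'⟩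
  refine ⟨n, ?_⟩
  rw [weight_eq, hn, hn']
  simp only [w, if_true, Bool.false_eq_true, if_false]
  rw [pow_mul_pow_eq_exp_klReal ht hst (by linarith) hr1, Real.exp_le_exp]
  have h3 := klReal_three_point hsq hqr.le hq hr1
  have ht0 : (0 : ℝ) ≤ t := by positivity
  nlinarith

/-- The index of an arm rarely falls below a level `q` that is less than its expected reward. -/
theorem exists_measureReal_index_deviation_le (k : V) {q : ℝ} (hq : 0 < q) (hqθ : q < θ k) :
    ∃ C, ∀ f : ℝ, (rewardLaw θ).real (indexDeviation π k q f) ≤ C * Real.exp (-f) := by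
  -- The room between `q` and `θ k` yields the factor `exp (-κ * t)`, which makes the union over all
  -- `t` and all `s ≤ t` summable, so no factor growing with `f` is lost.
  obtain ⟨r, hqr, hr⟩ := exists_between hqθ
  have hr1 : r < 1 := hr.trans_le (θ k).2.2
  set κ := klReal q r with hκdef
  have hκ : 0 < κ := klReal_pos hq.le (by linarith) (by linarith) hr1 hqr.ne
  have hsum : Summable fun t : ℕ => ((t : ℝ) + 1) * Real.exp (-κ * t) := by
    have h1 := Real.summable_pow_mul_exp_neg_nat_mul 1 hκ
    have h0 := Real.summable_pow_mul_exp_neg_nat_mul 0 hκ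
    simpa [add_mul] using h1.add h0
  refine ⟨∑' t : ℕ, ((t : ℝ) + 1) * Real.exp (-κ * t), fun f => ?_⟩
  let A : ℕ → ℕ → Set (V × ℕ → Bool) := fun t s =>
    {x | ∃ n, pulls k (play π x n) = t ∧ wins k (play π x n) = s ∧ t ≠ 0 ∧ (s / t : ℝ) ≤ q ∧
      f ≤ t * klReal (s / t) q}
  have hA : ∀ t s, s ≤ t → rewardLaw θ (A t s)
      ≤ ENNReal.ofReal (Real.exp (-f) * Real.exp (-κ * t)) := by
    intro t s hst
    rw [ENNReal.le_ofReal_iff_toReal_le (measure_ne_top _ _) (by positivity)]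
    by_cases hc : t ≠ 0 ∧ (s / t : ℝ) ≤ q ∧ f ≤ t * klReal (s / t) q
    · refine le_trans ?_ (measureReal_exists_counts_le θ π k hq hqr hr hc.1 hst hc.2.1 hc.2.2)
      refine measureReal_mono ?_
      rintro x ⟨n, h1, h2, -⟩
      exact ⟨n, h1, h2⟩
    · have : A t s = ∅ := by
        ext x; simp only [A, Set.mem_ofPred_eq, Set.mem_empty_iff_false, iff_false]
        rintro ⟨n, -, -, h⟩
        exact hc h
      rw [this]; simp; positivity
  have hsub : indexDeviation π k q f ⊆ ⋃ t : ℕ, ⋃ s ∈ Finset.range (t + 1), A t s := by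
    rintro x ⟨n, h1, h2, h3⟩
    simp only [Set.mem_iUnion]
    exact ⟨pulls k (play π x n), wins k (play π x n),
      Finset.mem_range.2 (Nat.lt_succ_of_le (wins_le_pulls _ _)), n, rfl, rfl, h1, h2, h3⟩
  have hmain : rewardLaw θ (indexDeviation π k q f)
      ≤ ENNReal.ofReal ((∑' t : ℕ, ((t : ℝ) + 1) * Real.exp (-κ * t)) * Real.exp (-f)) := by
    rw [← tsum_mul_right, ENNReal.ofReal_tsum_of_nonneg (fun t => by positivity)
      (hsum.mul_right _)]
    refine (measure_mono hsub).trans ((measure_iUnion_le _).trans (ENNReal.tsum_le_tsum fun t => ?_))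
    refine (measure_biUnion_finset_le _ _).trans ?_
    refine (Finset.sum_le_sum fun s hs => hA t s (by simpa [Nat.lt_succ_iff] using hs)).trans ?_
    rw [Finset.sum_const, Finset.card_range, nsmul_eq_mul, ← ENNReal.ofReal_natCast,
      ← ENNReal.ofReal_mul (by positivity)]
    apply le_of_eq
    push_cast
    ring_nf
  exact ENNReal.toReal_le_of_le_ofReal (mul_nonneg (tsum_nonneg fun t => by positivity)
    (Real.exp_pos _).le) hmain

end Deviations

/-! ### Series of order `o(log T)` -/

section Series

open Asymptotics

/-- Comparison with the divergent harmonic series, whose partial sums are of order `log T`. The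
terms need not be summable, so small `c` is allowed. -/
theorem isLittleO_sum_range_of_isLittleO_inv {r : ℕ → ℝ}
    (hr : r =o[atTop] fun s : ℕ => ((s : ℝ) + 1)⁻¹) :
    (fun T : ℕ => ∑ s ∈ Finset.range T, r s) =o[atTop] fun T : ℕ => Real.log T := by
  have hlog : Tendsto (fun n : ℕ => Real.log ((n : ℝ) + 1)) atTop atTop :=
    Real.tendsto_log_atTop.comp (tendsto_natCast_atTop_atTop.atTop_add tendsto_const_nhds)
  have hharm : ∀ n : ℕ, ∑ i ∈ Finset.range n, ((i : ℝ) + 1)⁻¹ = (harmonic n : ℝ) := by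
    intro n; simp [harmonic]
  have h := hr.sum_range (fun n => by positivity) (by
    refine tendsto_atTop_mono (fun n => ?_) hlog
    rw [hharm]
    exact_mod_cast log_add_one_le_harmonic n)
  refine h.trans_isBigO (IsBigO.of_bound 2 ?_)
  have h1 := (Real.tendsto_log_atTop.comp tendsto_natCast_atTop_atTop).eventually_ge_atTop 1
  filter_upwards [h1] with n hn
  simp only [Function.comp] at hn
  rw [hharm, Real.norm_of_nonneg, Real.norm_of_nonneg (by linarith)]
  · have := harmonic_le_one_add_log n
    linarith
  · rw [← hharm]; positivity

theorem exp_neg_mul_isLittleO {κ : ℝ} (hκ : 0 < κ) :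
    (fun s : ℕ => Real.exp (-(κ * s))) =o[atTop] fun s : ℕ => ((s : ℝ) + 1)⁻¹ := by
  rw [isLittleO_iff_tendsto' (Eventually.of_forall fun s h => absurd h (by positivity))]
  have h1 := (Real.summable_pow_mul_exp_neg_nat_mul 1 hκ).tendsto_atTop_zero
  have h0 := (Real.summable_pow_mul_exp_neg_nat_mul 0 hκ).tendsto_atTop_zero
  have h := h1.add h0
  rw [add_zero] at h
  refine h.congr fun s => ?_
  rw [div_inv_eq_mul, show -(κ * (s : ℝ)) = -κ * s by ring]
  ring

/-- The quotient is exactly `(log (s + 1)) ^ (-c)` once the logarithm is positive. -/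
theorem exp_neg_budget_isLittleO {c : ℝ} (hc : 0 < c) :
    (fun s : ℕ => Real.exp (-budget c (s + 1))) =o[atTop] fun s : ℕ => ((s : ℝ) + 1)⁻¹ := by
  rw [isLittleO_iff_tendsto' (Eventually.of_forall fun s h => absurd h (by positivity))]
  have hlog : Tendsto (fun n : ℕ => Real.log ((n : ℝ) + 1)) atTop atTop :=
    Real.tendsto_log_atTop.comp (tendsto_natCast_atTop_atTop.atTop_add tendsto_const_nhds)
  refine ((tendsto_rpow_neg_atTop hc).comp hlog).congr' ?_
  filter_upwards [hlog.eventually_gt_atTop 0] with s hs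
  have hs1 : (0 : ℝ) < s + 1 := by positivity
  simp only [Function.comp, div_inv_eq_mul]
  rw [budget, Real.rpow_def_of_pos hs, neg_add, Real.exp_add, Real.exp_neg (Real.log _)]
  push_cast
  rw [Real.exp_log hs1]
  field_simp

theorem budget_isLittleO (c : ℝ) :
    (fun n : ℕ => budget c n - Real.log n) =o[atTop] fun n : ℕ => Real.log n := by
  have h := (Real.isLittleO_log_id_atTop.comp_tendsto
    (Real.tendsto_log_atTop.comp tendsto_natCast_atTop_atTop)).const_mul_left c
  refine h.congr_left fun n => ?_
  simp [budget]

theorem eventually_budget_lt (c : ℝ) {ε : ℝ} (hε : 0 < ε) :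
    ∀ᶠ s : ℕ in atTop, max (budget c (s + 1)) 0 < ε * s := by
  have h1 : (fun n : ℕ => budget c n) =O[atTop] fun n : ℕ => Real.log n := by
    have := (budget_isLittleO c).isBigO.add (isBigO_refl (fun n : ℕ => Real.log n) atTop)
    simpa using this
  have h2 : (fun n : ℕ => budget c n) =o[atTop] fun n : ℕ => (n : ℝ) :=
    h1.trans_isLittleO (Real.isLittleO_log_id_atTop.comp_tendsto tendsto_natCast_atTop_atTop)
  have h3 := (h2.def (half_pos (half_pos hε)))
  have h4 := (tendsto_add_atTop_nat 1).eventually h3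
  filter_upwards [h4, eventually_ge_atTop 1] with s hs hs1
  have hs1' : (1 : ℝ) ≤ s := by exact_mod_cast hs1
  have h5 := (le_abs_self _).trans hs
  simp only [Real.norm_eq_abs] at h5
  rw [abs_of_nonneg (by positivity)] at h5
  push_cast at h5
  exact max_lt (by nlinarith) (by positivity)

theorem budget_le_max {c : ℝ} (hc : 0 < c) {s n : ℕ} (h : s ≤ n) :
    max (budget c s) 0 ≤ max (budget c n) 0 := by
  refine max_le ?_ (le_max_right _ _)
  rcases Nat.lt_or_ge s 2 with hs | hs
  -- At `0` and `1` both logarithms take the default value `log 0 = 0` or are `log 1 = 0`, so the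
  -- budget vanishes.
  · refine le_trans (le_of_eq ?_) (le_max_right _ _)
    interval_cases s <;> simp [budget]
  · have h1 : (1 : ℝ) < s := by exact_mod_cast hs
    have h2 : (s : ℝ) ≤ n := by exact_mod_cast h
    have h3 := Real.log_pos h1
    have h4 : Real.log s ≤ Real.log n := Real.log_le_log (by linarith) h2
    have h5 := Real.log_le_log h3 h4
    refine le_trans ?_ (le_max_left _ _)
    unfold budget
    gcongr

end Series

/-! ### Counting rounds -/

section Counting

open Classical in
-- The counter `Nat.count p` is injective on the rounds where `p` holds. This is what replaces time
-- by a counter in all error events.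
theorem card_filter_count_le (p : ℕ → Prop) [DecidablePred p] (Q : ℕ → Prop) (T : ℕ) :
    ((Finset.range T).filter fun m => p m ∧ Q (Nat.count p m)).card
      ≤ ((Finset.range (Nat.count p T)).filter Q).card := by
  refine Finset.card_le_card_of_injOn (Nat.count p) ?_ ?_
  · intro m hm
    simp only [Finset.coe_filter, Finset.mem_range, Set.mem_ofPred_eq] at hm ⊢
    exact ⟨Nat.count_strict_mono hm.2.1 hm.1, hm.2.2⟩
  · intro m hm n hn h
    simp only [Finset.coe_filter, Finset.mem_range, Set.mem_ofPred_eq] at hm hn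
    exact Nat.count_injective hm.2.1 hn.2.1 h

theorem card_filter_dvd_le {g : ℕ} (S : ℕ) :
    ((Finset.range S).filter fun s => g ∣ s).card ≤ S / g + 1 := by
  rw [← Finset.card_range (S / g + 1)]
  refine Finset.card_le_card_of_injOn (fun s => s / g) ?_ ?_
  · intro s hs
    simp only [Finset.coe_filter, Finset.mem_range, Set.mem_ofPred_eq, Finset.coe_range,
      Set.mem_Iio] at hs ⊢
    exact Nat.lt_succ_of_le (Nat.div_le_div_right hs.1.le)
  · intro m hm n hn h
    simp only [Finset.coe_filter, Finset.mem_range, Set.mem_ofPred_eq] at hm hn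
    rw [← Nat.div_mul_cancel hm.2, ← Nat.div_mul_cancel hn.2]
    exact congrArg (· * g) h

open Classical in
theorem card_filter_lt_le {y : ℝ} (hy : 0 ≤ y) (S : ℕ) :
    (((Finset.range S).filter fun t : ℕ => (t : ℝ) < y).card : ℝ) ≤ y + 1 := by
  have h : ((Finset.range S).filter fun t : ℕ => (t : ℝ) < y) ⊆ Finset.range ⌈y⌉₊ := by
    intro t ht
    rw [Finset.mem_filter] at ht
    exact Finset.mem_range.2 (Nat.lt_ceil.2 ht.2)
  have h1 := Finset.card_le_card h
  rw [Finset.card_range] at h1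
  have h2 : (((Finset.range S).filter fun t : ℕ => (t : ℝ) < y).card : ℝ) ≤ ⌈y⌉₊ := by
    exact_mod_cast h1
  exact h2.trans (Nat.ceil_lt_add_one hy).le

open Classical in
/-- The number of rounds led by `k` is controlled by the number of exceptional ones if in every
other round, except for one out of `g`, an arm is selected that has been selected rarely. -/
theorem count_le_of_forall_lt {V : Type*} [Fintype V] [DecidableEq V] [Nonempty V] (L A : ℕ → V) (k : V) {g : ℕ}
    (hg : 2 ≤ g) (Q : ℕ → Prop)
    (h : ∀ m, L m = k → ¬ g ∣ Nat.count (fun m => L m = k) m →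
      ¬ Q (Nat.count (fun m => L m = k) m) →
      (Nat.count (fun n => A n = A m) m : ℝ)
        < 1 / (4 * Fintype.card V) * Nat.count (fun m => L m = k) m) (T : ℕ) :
    (Nat.count (fun m => L m = k) T : ℝ)
      ≤ 4 * (1 + Fintype.card V + ((Finset.range T).filter Q).card) := by
  let p : ℕ → Prop := fun m => L m = k
  let _ : DecidablePred p := fun m => inferInstanceAs (Decidable (L m = k))
  set S := Nat.count p T with hS
  have hV : (0 : ℝ) < Fintype.card V := by exact_mod_cast Fintype.card_pos
  set y : ℝ := 1 / (4 * Fintype.card V) * S with hy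
  -- With `S` rounds led by `k`, the forced ones number at most `S / 2 + 1` since `g ≥ 2`, and those
  -- selecting an arm with fewer than `y = S / (4 * |V|)` samples at most `|V| * (y + 1) = S / 4 +
  -- |V|`. A quarter of `S` is left for the exceptional rounds, whence the factor `4`.
  have hcover : (Finset.range T).filter p
      ⊆ ((Finset.range T).filter fun m => p m ∧ g ∣ Nat.count p m)
        ∪ ((Finset.range T).filter fun m => p m ∧ Q (Nat.count p m))
        ∪ Finset.univ.biUnion fun j => (Finset.range T).filter fun m =>
            A m = j ∧ (Nat.count (fun n => A n = j) m : ℝ) < y := by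
    intro m hm
    rw [Finset.mem_filter] at hm
    have hmT := Finset.mem_range.1 hm.1
    by_cases h1 : g ∣ Nat.count p m
    · simp [hmT, hm.2, h1]
    by_cases h2 : Q (Nat.count p m)
    · simp [hmT, hm.2, h2]
    refine Finset.mem_union_right _ (Finset.mem_biUnion.2 ⟨A m, Finset.mem_univ _, ?_⟩)
    rw [Finset.mem_filter]
    refine ⟨hm.1, rfl, (h m hm.2 h1 h2).trans_le ?_⟩
    rw [hy]
    gcongr
    exact Nat.count_monotone p hmT.le
  have h1 : ((Finset.range T).filter fun m => p m ∧ g ∣ Nat.count p m).card ≤ S / g + 1 := by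
    refine le_trans ?_ (card_filter_dvd_le S)
    convert! card_filter_count_le p (fun s => g ∣ s) T
  have h2 := (card_filter_count_le p Q T).trans (Finset.card_le_card
    (Finset.filter_subset_filter Q (Finset.range_subset_range.2 (Nat.count_le p))))
  have h3 : ∀ j, (((Finset.range T).filter fun m =>
      A m = j ∧ (Nat.count (fun n => A n = j) m : ℝ) < y).card : ℝ) ≤ y + 1 := by
    intro j
    refine le_trans ?_ (card_filter_lt_le (by positivity) (Nat.count (fun n => A n = j) T))
    exact_mod_cast card_filter_count_le (fun n => A n = j) (fun t => (t : ℝ) < y) T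
  have hcard : (S : ℝ) ≤ (S / g + 1 : ℕ) + ((Finset.range T).filter Q).card
      + Fintype.card V * (y + 1) := by
    have e : S = ((Finset.range T).filter p).card := Nat.count_eq_card_filter_range p T
    have h4 : (((Finset.univ.biUnion fun j => (Finset.range T).filter fun m =>
            A m = j ∧ (Nat.count (fun n => A n = j) m : ℝ) < y) : Finset ℕ).card : ℝ)
        ≤ Fintype.card V * (y + 1) := by
      refine le_trans (Nat.cast_le.2 Finset.card_biUnion_le) ?_
      push_cast
      refine (Finset.sum_le_sum fun j _ => h3 j).trans ?_
      simp [mul_add]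
    have h5 : ((Finset.range T).filter p).card ≤ _ := (Finset.card_le_card hcover).trans
      ((Finset.card_union_le _ _).trans (Nat.add_le_add_right ((Finset.card_union_le _ _).trans
        (add_le_add h1 h2)) _))
    rw [← e] at h5
    have h6 : (S : ℝ) ≤ _ := Nat.cast_le.2 h5
    rw [Nat.cast_add, Nat.cast_add] at h6
    linarith
  have hdiv : ((S / g + 1 : ℕ) : ℝ) ≤ S / 2 + 1 := by
    push_cast
    have : S / g ≤ S / 2 := Nat.div_le_div_left hg two_pos
    have h7 : ((S / g : ℕ) : ℝ) ≤ (S / 2 : ℕ) := by exact_mod_cast this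
    have h8 : ((S / 2 : ℕ) : ℝ) ≤ S / 2 := Nat.cast_div_le
    linarith
  have hVy : Fintype.card V * (y + 1) = S / 4 + Fintype.card V := by
    rw [hy]; field_simp
  rw [hVy] at hcard
  have : (0 : ℝ) ≤ S := by positivity
  linarith

open Classical in
/-- If every `g`-th round led by `k` selects `k`, then `k` is selected in a fraction `1 / g` of the
rounds it leads. -/
theorem count_le_mul_count {V : Type*} [DecidableEq V] (L A : ℕ → V) (k : V) {g : ℕ}
    (hg : 0 < g) (h : ∀ m, L m = k → g ∣ Nat.count (fun m => L m = k) m → A m = k) (n : ℕ) :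
    Nat.count (fun m => L m = k) n ≤ g * Nat.count (fun m => A m = k) n := by
  induction n with
  | zero => simp
  | succ n ih =>
    rw [Nat.count_succ, Nat.count_succ]
    by_cases hL : L n = k
    · rw [if_pos hL]
      by_cases hd : g ∣ Nat.count (fun m => L m = k) n
      · rw [if_pos (h n hL hd)]
        nlinarith
      -- Equality would make the counter divisible by `g`, so the inequality is strict and has room
      -- for one more led round.
      · have : Nat.count (fun m => L m = k) n ≠ g * Nat.count (fun m => A m = k) n :=
          fun e => hd ⟨_, e⟩
        rw [mul_add]
        omega
    · rw [if_neg hL, mul_add]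
      omega

end Counting

/-! ### Sample paths of OSUB -/

section Paths

variable {V : Type*} [Fintype V] [DecidableEq V] (θ : V → unitInterval) (π : Policy V)

theorem pulls_play (x : V × ℕ → Bool) (k : V) (n : ℕ) :
    pulls k (play π x n) = Nat.count (fun m => π (play π x m) = k) n := by
  induction n with
  | zero => simp [play, pulls]
  | succ n ih => rw [play, pulls_cons, ih, Nat.count_succ]

/-- The round that follows the history is included in `leads`, hence `n + 1`. Thus the `leads - 1`
of the selection rule is the number of earlier rounds led by the current leader. -/
theorem leads_play (Λ : History V → V) (x : V × ℕ → Bool) (k : V) (n : ℕ) :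
    leads Λ (play π x n) k = Nat.count (fun m => Λ (play π x m) = k) (n + 1) := by
  induction n with
  | zero =>
    simp only [play, leads, Nat.count_succ]
    simp
    congr
  | succ n ih =>
    rw [Nat.count_succ, ← ih, leads, play, List.tails_cons, List.countP_cons]
    simp [leads]

theorem empMean_nonneg (k : V) (h : History V) : 0 ≤ empMean k h := by
  rw [empMean_eq]; positivity

theorem empMean_le_one (k : V) (h : History V) : empMean k h ≤ 1 :=
  div_le_one_of_le₀ (by exact_mod_cast wins_le_pulls k h) (by positivity)

theorem abs_empMean_sub_lt {x : V × ℕ → Bool} {k : V} {δ m : ℝ} (hx : x ∉ deviation θ π k δ m)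
    {n : ℕ} (hn : m ≤ pulls k (play π x n)) :
    pulls k (play π x n) ≠ 0 ∧ |empMean k (play π x n) - θ k| < δ := by
  have h : |(wins k (play π x n) : ℝ) - θ k * pulls k (play π x n)| < δ * pulls k (play π x n) := by
    by_contra! hle
    exact hx ⟨n, hn, hle⟩
  have h0 : pulls k (play π x n) ≠ 0 := by
    intro h0
    rw [h0] at h
    have := abs_nonneg ((wins k (play π x n) : ℝ) - θ k * (0 : ℕ))
    simp only [Nat.cast_zero, mul_zero] at h this
    linarith
  have hpos : (0 : ℝ) < pulls k (play π x n) := by exact_mod_cast Nat.pos_of_ne_zero h0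
  refine ⟨h0, ?_⟩
  have e : empMean k (play π x n) - θ k
      = ((wins k (play π x n) : ℝ) - θ k * pulls k (play π x n)) / pulls k (play π x n) := by
    rw [empMean_eq]; field_simp
  rwa [e, abs_div, abs_of_pos hpos, div_lt_iff₀ hpos]

/-- `Λ` chooses the leaders of the OSUB rule `π`. -/
def IsLeaderRule (G : SimpleGraph V) [DecidableRel G.Adj] (c : ℝ) (Λ : History V → V) : Prop :=
  ∀ h : History V, (∀ k, empMean k h ≤ empMean (Λ h) h) ∧
    if (G.maxDegree + 1) ∣ (leads Λ h (Λ h) - 1) then π h = Λ h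
    else (π h = Λ h ∨ G.Adj (π h) (Λ h)) ∧
      ∀ k, (k = Λ h ∨ G.Adj k (Λ h)) → armIndex c Λ h k ≤ armIndex c Λ h (π h)

variable {π} {G : SimpleGraph V} [DecidableRel G.Adj] {c : ℝ} {Λ : History V → V}

/-- The number of rounds led by `k` among the first `n`. -/
def ledRounds (π : Policy V) (Λ : History V → V) (x : V × ℕ → Bool) (k : V) (n : ℕ) : ℕ :=
  Nat.count (fun m => Λ (play π x m) = k) n

theorem leads_play_leader (x : V × ℕ → Bool) {k : V} {n : ℕ} (hk : Λ (play π x n) = k) :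
    leads Λ (play π x n) (Λ (play π x n)) = ledRounds π Λ x k n + 1 := by
  rw [leads_play, Nat.count_succ, if_pos rfl, hk, ledRounds]

theorem IsLeaderRule.eq_of_dvd (hΛ : IsLeaderRule π G c Λ) (x : V × ℕ → Bool) {k : V} {n : ℕ}
    (hk : Λ (play π x n) = k) (hd : G.maxDegree + 1 ∣ ledRounds π Λ x k n) :
    π (play π x n) = k := by
  have h := (hΛ (play π x n)).2
  rw [leads_play_leader x hk, Nat.add_sub_cancel, if_pos hd] at h
  exact h.trans hk

theorem IsLeaderRule.adj_or_eq (hΛ : IsLeaderRule π G c Λ) (h : History V) :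
    π h = Λ h ∨ G.Adj (π h) (Λ h) := by
  have h2 := (hΛ h).2
  split_ifs at h2
  · exact Or.inl h2
  · exact h2.1

theorem IsLeaderRule.index_le (hΛ : IsLeaderRule π G c Λ) (x : V × ℕ → Bool) {k : V} {n : ℕ}
    (hk : Λ (play π x n) = k) (hd : ¬ G.maxDegree + 1 ∣ ledRounds π Λ x k n) {i : V}
    (hi : i = k ∨ G.Adj i k) :
    klIndex c (empMean i (play π x n)) (pulls i (play π x n)) (ledRounds π Λ x k n + 1)
      ≤ klIndex c (empMean (π (play π x n)) (play π x n)) (pulls (π (play π x n)) (play π x n))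
          (ledRounds π Λ x k n + 1) := by
  have h := (hΛ (play π x n)).2
  rw [leads_play_leader x hk, Nat.add_sub_cancel, if_neg hd] at h
  have h2 := h.2 i (by rwa [hk])
  rwa [armIndex, armIndex, leads_play_leader x hk] at h2

/-- The forced selections ensure that an arm that has led often is well sampled, so its empirical
mean can be trusted. -/
theorem IsLeaderRule.ledRounds_le (hΛ : IsLeaderRule π G c Λ) (x : V × ℕ → Bool) (k : V) (n : ℕ) :
    ledRounds π Λ x k n ≤ (G.maxDegree + 1) * pulls k (play π x n) := by
  rw [pulls_play]
  exact count_le_mul_count (fun m => Λ (play π x m)) (fun m => π (play π x m)) k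
    (Nat.succ_pos _) (fun m hm hd => hΛ.eq_of_dvd x hm hd) n

/-- Otherwise the selected arm and the leader `k` both have empirical means within `δ` of the truth.
If the selected arm has a larger mean than `k`, the gap `4 * δ` contradicts the leadership of `k`.
If not, Pinsker's inequality and the small budget put its index below `θ k + 3 * δ`; the index of
`i` is no larger, which the last hypothesis excludes. -/
theorem IsLeaderRule.pulls_lt [Nonempty V] (hΛ : IsLeaderRule π G c Λ) {k i : V} (hik : G.Adj i k)
    {δ : ℝ} (hδ : 0 < δ) (hgap : ∀ j, θ k < θ j → (θ k + 4 * δ : ℝ) ≤ θ j) (hi : θ k < θ i)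
    {x : V × ℕ → Bool} {m : ℕ} (hm : Λ (play π x m) = k)
    (hd : ¬ G.maxDegree + 1 ∣ ledRounds π Λ x k m)
    (hbudget : max (budget c (ledRounds π Λ x k m + 1)) 0
      < 1 / (4 * Fintype.card V) * (δ ^ 2 / 2) * ledRounds π Λ x k m)
    (hdev : ∀ j, x ∉ deviation θ π j δ (1 / (4 * Fintype.card V) * ledRounds π Λ x k m))
    (hindex : x ∉ indexDeviation π i (θ k + 3 * δ) (budget c (ledRounds π Λ x k m + 1))) :
    (pulls (π (play π x m)) (play π x m) : ℝ)
      < 1 / (4 * Fintype.card V) * ledRounds π Λ x k m := by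
  set s := ledRounds π Λ x k m with hs
  set h := play π x m with hh
  by_contra! hle
  have hV : (0 : ℝ) < Fintype.card V := by exact_mod_cast Fintype.card_pos
  have hk0 : (0 : ℝ) ≤ θ k := (θ k).2.1
  have hi1 : (θ i : ℝ) ≤ 1 := (θ i).2.2
  have hki := hgap i hi
  have hleader : 1 / (4 * Fintype.card V) * (s : ℝ) ≤ pulls k h := by
    have h1 : (s : ℝ) ≤ (G.maxDegree + 1 : ℕ) * pulls k h := by
      exact_mod_cast hΛ.ledRounds_le x k m
    have h2 : ((G.maxDegree + 1 : ℕ) : ℝ) ≤ Fintype.card V := by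
      exact_mod_cast G.maxDegree_lt_card_verts
    rw [one_div_mul_eq_div, div_le_iff₀ (by positivity)]
    nlinarith [(Nat.cast_nonneg (pulls k h) : (0 : ℝ) ≤ pulls k h)]
  obtain ⟨hj0, hj⟩ := abs_empMean_sub_lt θ π (hdev (π h)) hle
  obtain ⟨-, hk⟩ := abs_empMean_sub_lt θ π (hdev k) hleader
  rw [abs_lt] at hj hk
  rw [← hh] at hj hk
  have hmax := (hΛ h).1 (π h)
  rw [hm] at hmax
  rcases lt_or_ge (θ k) (θ (π h)) with hlt | hge
  · have := hgap _ hlt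
    linarith
  · have hge' : (θ (π h) : ℝ) ≤ θ k := hge
    have h1 := hΛ.index_le x hm hd (Or.inr hik)
    have h2 := klIndex_le_add (c := c) (n := s + 1) (empMean_nonneg (π h) h) hδ hj0
      (hbudget.trans_le (by
        calc 1 / (4 * (Fintype.card V : ℝ)) * (δ ^ 2 / 2) * s
            = 1 / (4 * (Fintype.card V : ℝ)) * s * (δ ^ 2 / 2) := by ring
          _ ≤ _ := by gcongr))
    have h3 := budget_lt_of_klIndex_lt (q := θ k + 3 * δ) (empMean_le_one i h) (by linarith)
      (by linarith) (lt_of_le_of_lt (h1.trans h2) (by linarith))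
    exact hindex ⟨m, h3.1, h3.2.1.le, h3.2.2.le⟩

/-- The index of `k` is at least that of the leader, hence at least the leader's empirical mean,
which exceeds `θ kstar - δ`. Concentration of the leader's mean thus suffices and no index deviation
of the best arm enters. -/
theorem IsLeaderRule.pulls_le (hc : 0 < c) (hΛ : IsLeaderRule π G c Λ) {k kstar : V}
    (hadj : G.Adj k kstar) {δ : ℝ} (hδ : 0 < δ) (hgap : (θ k + δ : ℝ) < θ kstar - δ)
    {x : V × ℕ → Bool} {m T : ℕ} (hmT : m < T) (hm : Λ (play π x m) = kstar)
    (hmk : π (play π x m) = k)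
    (hdev : x ∉ deviation θ π kstar δ (1 / (G.maxDegree + 1 : ℕ) * ledRounds π Λ x kstar m))
    (hdev' : x ∉ deviation θ π k δ (pulls k (play π x m))) :
    (pulls k (play π x m) : ℝ) ≤ max (budget c T) 0 / klReal (θ k + δ) (θ kstar - δ) := by
  have hne : k ≠ kstar := hadj.ne
  have hd : ¬ G.maxDegree + 1 ∣ ledRounds π Λ x kstar m := fun hd =>
    hne (hmk.symm.trans (hΛ.eq_of_dvd x hm hd))
  have hk0 : (0 : ℝ) ≤ θ k := (θ k).2.1
  have hs1 : (θ kstar : ℝ) ≤ 1 := (θ kstar).2.2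
  have hleader : 1 / (G.maxDegree + 1 : ℕ) * (ledRounds π Λ x kstar m : ℝ)
      ≤ pulls kstar (play π x m) := by
    have h1 : (ledRounds π Λ x kstar m : ℝ) ≤ (G.maxDegree + 1 : ℕ) * pulls kstar (play π x m) := by
      exact_mod_cast hΛ.ledRounds_le x kstar m
    rw [one_div_mul_eq_div, div_le_iff₀ (by positivity)]
    linarith
  obtain ⟨-, h1⟩ := abs_empMean_sub_lt θ π hdev hleader
  obtain ⟨h0, h2⟩ := abs_empMean_sub_lt θ π hdev' le_rfl
  rw [abs_lt] at h1 h2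
  have h3 := hΛ.index_le x hm hd (Or.inl rfl)
  rw [hmk] at h3
  have h4 := le_klIndex (c := c) (empMean_le_one kstar (play π x m))
    (pulls kstar (play π x m)) (ledRounds π Λ x kstar m + 1)
  have h5 := mul_klReal_le_of_lt_klIndex (y := θ kstar - δ) (by linarith) (by linarith)
    (by linarith) h0 (lt_of_lt_of_le (by linarith) (h4.trans h3))
  have h6 : ledRounds π Λ x kstar m + 1 ≤ T := (Nat.succ_le_succ (Nat.count_le _)).trans hmT
  have h7 := klReal_anti_left (q := θ k + δ) (r := θ kstar - δ)
    (empMean_nonneg k (play π x m)) (by linarith) (by linarith)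
    hgap.le (by linarith)
  have h8 := klReal_pos (p := θ k + δ) (q := θ kstar - δ) (by linarith) (by linarith) (by linarith)
    (by linarith) hgap.ne
  rw [le_div_iff₀ h8]
  exact (mul_le_mul_of_nonneg_left h7 (by positivity)).trans (h5.trans (budget_le_max hc h6))

end Paths

/-! ### The expected number of selections under OSUB -/

section Expectation

open Asymptotics

variable {V : Type*} [Fintype V] [DecidableEq V] (θ : V → unitInterval) (π : Policy V)

theorem measurableSet_exists_play (P : History V → Prop) :
    MeasurableSet {x : V × ℕ → Bool | ∃ n, P (play π x n)} := by
  have : {x : V × ℕ → Bool | ∃ n, P (play π x n)} = ⋃ n, {x | play π x n ∈ {h | P h}} := by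
    ext; simp
  rw [this]
  exact MeasurableSet.iUnion fun n => measurableSet_play_mem π n _

theorem measurableSet_deviation (k : V) (δ m : ℝ) : MeasurableSet (deviation θ π k δ m) :=
  measurableSet_exists_play π fun h => m ≤ pulls k h ∧
    δ * pulls k h ≤ |(wins k h : ℝ) - θ k * pulls k h|

theorem measurableSet_indexDeviation (k : V) (q f : ℝ) :
    MeasurableSet (indexDeviation π k q f) :=
  measurableSet_exists_play π fun h => pulls k h ≠ 0 ∧ empMean k h ≤ q ∧
    f ≤ pulls k h * klReal (empMean k h) q

open Classical in
theorem integrable_card_filter_mem {B : ℕ → Set (V × ℕ → Bool)} (hB : ∀ s, MeasurableSet (B s))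
    (T : ℕ) :
    Integrable (fun x => (((Finset.range T).filter fun s => x ∈ B s).card : ℝ)) (rewardLaw θ) := by
  simp_rw [Finset.card_filter, Nat.cast_sum]
  refine integrable_finsetSum _ fun s _ => ?_
  have := (integrable_const (μ := rewardLaw θ) (1 : ℝ)).indicator (hB s)
  refine this.congr (ae_of_all _ fun x => ?_)
  by_cases hx : x ∈ B s <;> simp [hx]

open Classical in
theorem integral_card_filter_mem {B : ℕ → Set (V × ℕ → Bool)} (hB : ∀ s, MeasurableSet (B s))
    (T : ℕ) :
    ∫ x, (((Finset.range T).filter fun s => x ∈ B s).card : ℝ) ∂(rewardLaw θ)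
      = ∑ s ∈ Finset.range T, (rewardLaw θ).real (B s) := by
  have e : ∀ x, (((Finset.range T).filter fun s => x ∈ B s).card : ℝ)
      = ∑ s ∈ Finset.range T, (B s).indicator (fun _ => (1 : ℝ)) x := by
    intro x
    rw [Finset.card_filter, Nat.cast_sum]
    refine Finset.sum_congr rfl fun s _ => ?_
    by_cases hx : x ∈ B s <;> simp [hx]
  simp_rw [e]
  rw [integral_finsetSum _ fun s _ => (integrable_const (1 : ℝ)).indicator (hB s)]
  refine Finset.sum_congr rfl fun s _ => ?_
  rw [integral_indicator_const _ (hB s), smul_eq_mul, mul_one]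

theorem const_isLittleO_log (C : ℝ) :
    (fun _ : ℕ => C) =o[atTop] fun T : ℕ => Real.log T :=
  isLittleO_const_left.2 (Or.inr (tendsto_norm_atTop_atTop.comp
    (Real.tendsto_log_atTop.comp tendsto_natCast_atTop_atTop)))

theorem measureReal_deviation_isLittleO (k : V) {δ ε : ℝ} (hδ : 0 < δ) (hε : 0 < ε) :
    (fun s : ℕ => (rewardLaw θ).real (deviation θ π k δ (ε * s)))
      =o[atTop] fun s : ℕ => ((s : ℝ) + 1)⁻¹ := by
  obtain ⟨κ, hκ, h⟩ := exists_measureReal_deviation_le θ π k hδ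
  refine IsBigO.trans_isLittleO ?_ (exp_neg_mul_isLittleO (mul_pos hκ hε))
  refine IsBigO.of_bound 2 (Eventually.of_forall fun s => ?_)
  rw [Real.norm_of_nonneg measureReal_nonneg, Real.norm_of_nonneg (Real.exp_pos _).le, mul_assoc]
  exact h _

theorem measureReal_indexDeviation_isLittleO {c : ℝ} (hc : 0 < c) (k : V) {q : ℝ} (hq : 0 < q)
    (hqθ : q < θ k) :
    (fun s : ℕ => (rewardLaw θ).real (indexDeviation π k q (budget c (s + 1))))
      =o[atTop] fun s : ℕ => ((s : ℝ) + 1)⁻¹ := by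
  obtain ⟨C, h⟩ := exists_measureReal_index_deviation_le θ π k hq hqθ
  refine IsBigO.trans_isLittleO ?_ (exp_neg_budget_isLittleO hc)
  refine IsBigO.of_bound C (Eventually.of_forall fun s => ?_)
  rw [Real.norm_of_nonneg measureReal_nonneg, Real.norm_of_nonneg (Real.exp_pos _).le]
  exact h _

variable {π} {G : SimpleGraph V} [DecidableRel G.Adj] {c : ℝ} {Λ : History V → V}

theorem integral_const_add {Ω : Type*} [MeasurableSpace Ω] {μ : Measure Ω}
    [IsProbabilityMeasure μ] {f : Ω → ℝ} (hf : Integrable f μ) (C : ℝ) :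
    ∫ x, (C + f x) ∂μ = C + ∫ x, f x ∂μ := by
  rw [integral_add (integrable_const C) hf]; simp

theorem exists_gap (k : V) : ∃ δ : ℝ, 0 < δ ∧ ∀ j, θ k < θ j → (θ k + 4 * δ : ℝ) ≤ θ j := by
  have h : ∀ j, ∃ δ : ℝ, 0 < δ ∧ (θ k < θ j → (θ k + 4 * δ : ℝ) ≤ θ j) := by
    intro j
    by_cases hj : θ k < θ j
    · have hj' : (θ k : ℝ) < θ j := hj
      exact ⟨(θ j - θ k) / 4, by linarith, fun _ => by linarith⟩
    · exact ⟨1, one_pos, fun h => absurd h hj⟩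
  choose d hd0 hd using h
  have : Nonempty V := ⟨k⟩
  obtain ⟨i, hi⟩ := Finite.exists_min d
  exact ⟨d i, hd0 i, fun j hj => by linarith [hd j hj, hi j]⟩

theorem integrable_ledRounds (k : V) (T : ℕ) :
    Integrable (fun x => (ledRounds π Λ x k T : ℝ)) (rewardLaw θ) := by
  have e : ∀ x, (ledRounds π Λ x k T : ℝ)
      = ∑ m ∈ Finset.range T, if Λ (play π x m) = k then 1 else 0 := by
    intro x
    rw [ledRounds, Nat.count_eq_card_filter_range, Finset.card_filter]
    push_cast
    rfl
  simp_rw [e]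
  exact integrable_finsetSum _ fun m _ =>
    integrable_comp_play θ π (fun h => if Λ h = k then 1 else 0) m

theorem IsLeaderRule.integral_ledRounds_isLittleO (hc : 0 < c) (hΛ : IsLeaderRule π G c Λ)
    {k i : V} (hik : G.Adj i k) (hi : θ k < θ i) :
    (fun T : ℕ => ∫ x, (ledRounds π Λ x k T : ℝ) ∂(rewardLaw θ))
      =o[atTop] fun T : ℕ => Real.log T := by
  classical
  have : Nonempty V := ⟨k⟩
  obtain ⟨δ, hδ, hgap⟩ := exists_gap θ k
  have hV : (0 : ℝ) < Fintype.card V := by exact_mod_cast Fintype.card_pos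
  set ε : ℝ := 1 / (4 * Fintype.card V) with hε
  have hε0 : 0 < ε := by positivity
  have hki := hgap i hi
  have hk0 : (0 : ℝ) ≤ θ k := (θ k).2.1
  obtain ⟨s₀, hs₀⟩ := eventually_atTop.1
    (eventually_budget_lt c (ε := ε * (δ ^ 2 / 2)) (by positivity))
  -- The bad event when `k` has led `s` rounds. For `s < s₀` the budget may still be too large, so
  -- these finitely many values are declared bad.
  obtain ⟨B, hBdef⟩ : ∃ B : ℕ → Set (V × ℕ → Bool), ∀ s, B s =
    {x | s < s₀} ∪ (⋃ j, deviation θ π j δ (ε * s))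
      ∪ indexDeviation π i (θ k + 3 * δ) (budget c (s + 1)) := ⟨_, fun _ => rfl⟩
  have hB : ∀ s, MeasurableSet (B s) := fun s => hBdef s ▸
    ((MeasurableSet.const _).union (MeasurableSet.iUnion fun j =>
      measurableSet_deviation θ π j _ _)).union (measurableSet_indexDeviation π i _ _)
  have hBo : (fun s => (rewardLaw θ).real (B s)) =o[atTop] fun s : ℕ => ((s : ℝ) + 1)⁻¹ := by
    have h1 : (fun s : ℕ => ∑ j, (rewardLaw θ).real (deviation θ π j δ (ε * s)))
        =o[atTop] fun s : ℕ => ((s : ℝ) + 1)⁻¹ :=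
      IsLittleO.fun_sum fun j _ => measureReal_deviation_isLittleO θ π j hδ hε0
    have h2 := measureReal_indexDeviation_isLittleO θ π hc i (q := θ k + 3 * δ)
      (by linarith) (by linarith)
    refine IsBigO.trans_isLittleO (IsBigO.of_bound 1 ?_) (h1.add h2)
    filter_upwards [eventually_ge_atTop s₀] with s hs
    have h3 : {x : V × ℕ → Bool | s < s₀} = ∅ :=
      Set.eq_empty_of_forall_notMem fun x (hx : s < s₀) => absurd hx (not_lt.2 hs)
    rw [Real.norm_of_nonneg measureReal_nonneg, one_mul]
    refine le_trans ?_ (le_abs_self _)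
    rw [hBdef]
    refine (measureReal_union_le _ _).trans (add_le_add_left ?_ _)
    rw [h3, Set.empty_union]
    exact measureReal_iUnion_fintype_le _
  have hpath : ∀ (x : V × ℕ → Bool) (T : ℕ), (ledRounds π Λ x k T : ℝ)
      ≤ 4 * (1 + Fintype.card V + ((Finset.range T).filter fun s => x ∈ B s).card) := by
    intro x T
    rw [ledRounds]
    refine count_le_of_forall_lt (fun m => Λ (play π x m)) (fun m => π (play π x m)) k
      (g := G.maxDegree + 1) ?_ (fun s => x ∈ B s) ?_ T
    -- The neighbour `i` forces a positive maximal degree, so at most about half of the rounds led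
    -- by `k` are forced.
    · have := G.degree_le_maxDegree k
      have h1 : 0 < G.degree k := (G.degree_pos_iff_exists_adj k).2 ⟨i, hik.symm⟩
      omega
    · intro m hm hd hQ
      simp only [hBdef, Set.mem_union, Set.mem_iUnion, Set.mem_ofPred_eq, not_or, not_exists,
        not_lt] at hQ
      rw [← pulls_play π x]
      exact hΛ.pulls_lt θ hik hδ hgap hi hm hd (hs₀ _ hQ.1.1) hQ.1.2 hQ.2
  have hbound : ∀ T : ℕ, ∫ x, (ledRounds π Λ x k T : ℝ) ∂(rewardLaw θ)
      ≤ 4 * (1 + Fintype.card V + ∑ s ∈ Finset.range T, (rewardLaw θ).real (B s)) := by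
    intro T
    rw [← integral_card_filter_mem θ hB T]
    have h1 := integrable_card_filter_mem θ hB T
    rw [← integral_const_add h1, ← integral_const_mul]
    exact integral_mono (integrable_ledRounds θ k T)
      (((integrable_const _).add h1).const_mul _) fun x => hpath x T
  have ho : (fun T : ℕ => 4 * (1 + Fintype.card V + ∑ s ∈ Finset.range T, (rewardLaw θ).real (B s)))
      =o[atTop] fun T : ℕ => Real.log T :=
    ((const_isLittleO_log _).add (isLittleO_sum_range_of_isLittleO_inv hBo)).const_mul_left 4
  refine IsBigO.trans_isLittleO (IsBigO.of_bound 1 (Eventually.of_forall fun T => ?_)) ho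
  rw [one_mul, Real.norm_of_nonneg (integral_nonneg fun x => by positivity)]
  exact (hbound T).trans (le_abs_self _)

theorem pulls_le_sum_ledRounds_add (π : Policy V) (Λ : History V → V) (k kstar : V)
    (x : V × ℕ → Bool) (T : ℕ) :
    pulls k (play π x T) ≤ ∑ j with j ≠ kstar, ledRounds π Λ x j T
      + ((Finset.range T).filter fun m => Λ (play π x m) = kstar ∧ π (play π x m) = k).card := by
  classical
  rw [pulls_play, Nat.count_eq_card_filter_range]
  have hsub : ((Finset.range T).filter fun m => π (play π x m) = k)
      ⊆ ((Finset.univ.filter fun j => j ≠ kstar).biUnion fun j =>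
          (Finset.range T).filter fun m => Λ (play π x m) = j)
        ∪ ((Finset.range T).filter fun m => Λ (play π x m) = kstar ∧ π (play π x m) = k) := by
    intro m hm
    rw [Finset.mem_filter] at hm
    by_cases h : Λ (play π x m) = kstar
    · exact Finset.mem_union_right _ (Finset.mem_filter.2 ⟨hm.1, h, hm.2⟩)
    · refine Finset.mem_union_left _ (Finset.mem_biUnion.2 ⟨_, ?_, Finset.mem_filter.2 ⟨hm.1, rfl⟩⟩)
      simpa using h
  refine (Finset.card_le_card hsub).trans ((Finset.card_union_le _ _).trans
    (Nat.add_le_add_right (Finset.card_biUnion_le.trans (le_of_eq ?_)) _))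
  exact Finset.sum_congr rfl fun j _ => (Nat.count_eq_card_filter_range _ _).symm

/-- Two different counters index the errors: deviations of `k` are charged to its own number of
selections, those of `kstar` to the number of rounds it has led. -/
theorem IsLeaderRule.card_filter_leader_le (hc : 0 < c) (hΛ : IsLeaderRule π G c Λ)
    {k kstar : V} (hadj : G.Adj k kstar) {δ : ℝ} (hδ : 0 < δ)
    (hgap : (θ k + δ : ℝ) < θ kstar - δ) (x : V × ℕ → Bool) (T : ℕ) :
    open Classical in
    (((Finset.range T).filter fun m => Λ (play π x m) = kstar ∧ π (play π x m) = k).card : ℝ)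
      ≤ max (budget c T) 0 / klReal (θ k + δ) (θ kstar - δ) + 2
        + ((Finset.range T).filter fun t : ℕ => x ∈ deviation θ π k δ (1 * t)).card
        + ((Finset.range T).filter fun s : ℕ =>
            x ∈ deviation θ π kstar δ (1 / (G.maxDegree + 1 : ℕ) * s)).card := by
  classical
  set K := max (budget c T) 0 / klReal (θ k + δ) (θ kstar - δ) with hK
  have hk0 : (0 : ℝ) ≤ θ k := (θ k).2.1
  have hs1 : (θ kstar : ℝ) ≤ 1 := (θ kstar).2.2
  have hK0 : 0 ≤ K := div_nonneg (le_max_right _ _)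
    (klReal_nonneg (by linarith) (by linarith) (by linarith) (by linarith))
  let A : ℕ → Prop := fun m => π (play π x m) = k
  let L : ℕ → Prop := fun m => Λ (play π x m) = kstar
  let Q : ℕ → Prop := fun t => x ∈ deviation θ π k δ (1 * t)
  let R : ℕ → Prop := fun s => x ∈ deviation θ π kstar δ (1 / (G.maxDegree + 1 : ℕ) * s)
  have hsub : ((Finset.range T).filter fun m => Λ (play π x m) = kstar ∧ π (play π x m) = k)
      ⊆ ((Finset.range T).filter fun m => A m ∧ (Nat.count A m : ℝ) < K + 1)
        ∪ ((Finset.range T).filter fun m => A m ∧ Q (Nat.count A m))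
        ∪ ((Finset.range T).filter fun m => L m ∧ R (Nat.count L m)) := by
    intro m hm
    simp only [Finset.mem_filter, Finset.mem_range] at hm
    obtain ⟨hmT, hmL, hmA⟩ := hm
    have e1 : Nat.count A m = pulls k (play π x m) := by
      rw [pulls_play]
    have e2 : Nat.count L m = ledRounds π Λ x kstar m := by
      rw [ledRounds]
    simp only [Finset.mem_union, Finset.mem_filter, Finset.mem_range, hmT, true_and]
    by_cases h1 : R (Nat.count L m)
    · exact Or.inr ⟨hmL, h1⟩
    by_cases h2 : Q (Nat.count A m)
    · exact Or.inl (Or.inr ⟨hmA, h2⟩)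
    refine Or.inl (Or.inl ⟨hmA, ?_⟩)
    simp only [R, Q, e1, e2, one_mul] at h1 h2
    have := hΛ.pulls_le θ hc hadj hδ hgap hmT hmL hmA h1 h2
    rw [e1]
    linarith
  have h1 : (((Finset.range T).filter fun m => A m ∧ (Nat.count A m : ℝ) < K + 1).card : ℝ)
      ≤ K + 2 := by
    have h2 := card_filter_count_le A (fun t => (t : ℝ) < K + 1) T
    have h3 := card_filter_lt_le (y := K + 1) (by linarith) (Nat.count A T)
    have h4 : (((Finset.range T).filter fun m => A m ∧ (Nat.count A m : ℝ) < K + 1).card : ℝ)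
      ≤ _ := Nat.cast_le.2 h2
    linarith
  have hmono : ∀ (p : ℕ → Prop) [DecidablePred p] (Q : ℕ → Prop), ((Finset.range T).filter fun m => p m ∧ Q (Nat.count p m)).card
      ≤ ((Finset.range T).filter Q).card := fun p _ Q =>
    (card_filter_count_le p Q T).trans (Finset.card_le_card
      (Finset.filter_subset_filter Q (Finset.range_subset_range.2 (Nat.count_le p))))
  have h2 : (((Finset.range T).filter fun m => A m ∧ Q (Nat.count A m)).card : ℝ) ≤ _ :=
    Nat.cast_le.2 (hmono A Q)
  have h3 : (((Finset.range T).filter fun m => L m ∧ R (Nat.count L m)).card : ℝ) ≤ _ :=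
    Nat.cast_le.2 (hmono L R)
  have h4 : (((Finset.range T).filter fun m =>
      Λ (play π x m) = kstar ∧ π (play π x m) = k).card : ℝ) ≤ _ :=
    Nat.cast_le.2 ((Finset.card_le_card hsub).trans
      ((Finset.card_union_le _ _).trans (Nat.add_le_add_right (Finset.card_union_le _ _) _)))
  push_cast at h4
  linarith

/-- The expected number of selections of an arm. -/
def meanPulls (θ : V → unitInterval) (π : Policy V) (k : V) (T : ℕ) : ℝ :=
  ∫ x, (pulls k (play π x T) : ℝ) ∂(rewardLaw θ)

theorem meanPulls_nonneg (k : V) (T : ℕ) : 0 ≤ meanPulls θ π k T :=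
  integral_nonneg fun _ => by positivity

/-- Such an arm is never selected while `kstar` leads, so every selection is charged to a suboptimal
leader. -/
theorem IsLeaderRule.meanPulls_isLittleO_of_not_adj (hΛ : IsLeaderRule π G c Λ)
    {k kstar : V} (hk : k ≠ kstar) (hadj : ¬ G.Adj k kstar)
    (hled : ∀ j ≠ kstar, (fun T : ℕ => ∫ x, (ledRounds π Λ x j T : ℝ) ∂(rewardLaw θ))
      =o[atTop] fun T : ℕ => Real.log T) :
    (fun T => meanPulls θ π k T) =o[atTop] fun T : ℕ => Real.log T := by
  have h : ∀ T, meanPulls θ π k T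
      ≤ ∑ j with j ≠ kstar, ∫ x, (ledRounds π Λ x j T : ℝ) ∂(rewardLaw θ) := by
    intro T
    rw [← integral_finsetSum _ fun j _ => integrable_ledRounds θ j T]
    refine integral_mono (integrable_comp_play θ π (fun h => (pulls k h : ℝ)) T)
      (integrable_finsetSum _ fun j _ => integrable_ledRounds θ j T) fun x => ?_
    have h1 := pulls_le_sum_ledRounds_add π Λ k kstar x T
    rw [Finset.filter_false_of_mem (s := Finset.range T), Finset.card_empty, add_zero] at h1
    · rw [← Nat.cast_sum]
      exact Nat.cast_le.2 h1
    · rintro m - ⟨h2, h3⟩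
      rcases hΛ.adj_or_eq (play π x m) with h4 | h4
      · exact hk (by rw [← h2, ← h3, h4])
      · rw [h2, h3] at h4; exact hadj h4
  have ho : (fun T : ℕ => ∑ j with j ≠ kstar, ∫ x, (ledRounds π Λ x j T : ℝ) ∂(rewardLaw θ))
      =o[atTop] fun T : ℕ => Real.log T :=
    IsLittleO.fun_sum fun j hj => hled j (by simpa using hj)
  refine IsBigO.trans_isLittleO (IsBigO.of_bound 1 (Eventually.of_forall fun T => ?_)) ho
  rw [one_mul, Real.norm_of_nonneg (meanPulls_nonneg θ k T)]
  exact (h T).trans (le_abs_self _)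

theorem IsLeaderRule.meanPulls_le_of_adj (hc : 0 < c) (hΛ : IsLeaderRule π G c Λ)
    {k kstar : V} (hadj : G.Adj k kstar) {δ : ℝ} (hδ : 0 < δ)
    (hgap : (θ k + δ : ℝ) < θ kstar - δ)
    (hled : ∀ j ≠ kstar, (fun T : ℕ => ∫ x, (ledRounds π Λ x j T : ℝ) ∂(rewardLaw θ))
      =o[atTop] fun T : ℕ => Real.log T) :
    ∃ r : ℕ → ℝ, (r =o[atTop] fun T : ℕ => Real.log T) ∧ ∀ T, meanPulls θ π k T
      ≤ max (budget c T) 0 / klReal (θ k + δ) (θ kstar - δ) + r T := by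
  classical
  have hm1 : ∀ t : ℕ, MeasurableSet (deviation θ π k δ (1 * t)) := fun t =>
    measurableSet_deviation θ π k δ _
  have hm2 : ∀ s : ℕ, MeasurableSet (deviation θ π kstar δ (1 / (G.maxDegree + 1 : ℕ) * s)) :=
    fun s => measurableSet_deviation θ π kstar δ _
  refine ⟨fun T => (∑ j with j ≠ kstar, ∫ x, (ledRounds π Λ x j T : ℝ) ∂(rewardLaw θ)) + 2
    + (∑ t ∈ Finset.range T, (rewardLaw θ).real (deviation θ π k δ (1 * t)))
    + ∑ s ∈ Finset.range T,
        (rewardLaw θ).real (deviation θ π kstar δ (1 / (G.maxDegree + 1 : ℕ) * s)), ?_, ?_⟩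
  · refine (((IsLittleO.fun_sum fun j hj => hled j (by simpa using hj)).add
      (const_isLittleO_log 2)).add (isLittleO_sum_range_of_isLittleO_inv
      (measureReal_deviation_isLittleO θ π k hδ one_pos))).add
      (isLittleO_sum_range_of_isLittleO_inv
      (measureReal_deviation_isLittleO θ π kstar hδ (by positivity)))
  · intro T
    have i0 := integrable_finsetSum (Finset.univ.filter fun j => j ≠ kstar) fun j _ =>
      integrable_ledRounds (π := π) (Λ := Λ) θ j T
    have i1 := integrable_card_filter_mem θ hm1 T
    have i2 := integrable_card_filter_mem θ hm2 T
    beta_reduce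
    rw [← integral_card_filter_mem θ hm1, ← integral_card_filter_mem θ hm2,
      ← integral_finsetSum _ fun j _ => integrable_ledRounds θ j T]
    set C := max (budget c T) 0 / klReal (θ k + δ) (θ kstar - δ) with hC
    have i01 : Integrable (fun x => _) (rewardLaw θ) := i0.add i1
    have i012 : Integrable (fun x => _) (rewardLaw θ) := i01.add i2
    simp only [Pi.add_apply] at i01 i012
    rw [show ∀ a b d : ℝ, C + (a + 2 + b + d) = (C + 2) + (a + b + d) by intros; ring,
      ← integral_add i0 i1, ← integral_add i01 i2, ← integral_const_add i012]
    refine integral_mono (integrable_comp_play θ π (fun h => (pulls k h : ℝ)) T)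
      ((integrable_const _).add i012) fun x => ?_
    have h1 : (pulls k (play π x T) : ℝ) ≤ _ :=
      Nat.cast_le.2 (pulls_le_sum_ledRounds_add π Λ k kstar x T)
    have h2 := hΛ.card_filter_leader_le θ hc hadj hδ hgap x T
    push_cast at h1
    linarith

end Expectation

/-! ### The lower bound -/

section LowerBound

open Asymptotics

variable {V : Type*} [Fintype V] [DecidableEq V] (θ : V → unitInterval) (π : Policy V)

theorem pulls_play_le (x : V × ℕ → Bool) (k : V) (n : ℕ) : pulls k (play π x n) ≤ n := by
  rw [pulls_play]; exact Nat.count_le _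

theorem sum_pulls (h : History V) : ∑ k, pulls k h = h.length := by
  induction h with
  | nil => simp [pulls]
  | cons e h ih => simp [pulls_cons, Finset.sum_add_distrib, ih]

theorem sum_meanPulls (T : ℕ) : ∑ k, meanPulls θ π k T = T := by
  unfold meanPulls
  rw [← integral_finsetSum _ fun k _ => integrable_comp_play θ π (fun h => (pulls k h : ℝ)) T]
  have : ∀ x, ∑ k, (pulls k (play π x T) : ℝ) = T := by
    intro x
    rw [← Nat.cast_sum, sum_pulls, length_play]
  simp [this]

/-- The sum of `ρ b` over all rewards `b` of arm `k`. -/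
def rewardSum (ρ : Bool → ℝ) (k : V) : History V → ℝ
  | [] => 0
  | e :: h => (if e.1 = k then ρ e.2 else 0) + rewardSum ρ k h

/-- The logarithm of the likelihood ratio of one reward, for mean `q` against mean `p`. -/
def logRatio (p q : ℝ) (b : Bool) : ℝ :=
  if b then Real.log (q / p) else Real.log ((1 - q) / (1 - p))

theorem mul_exp_log_div_le {p q : ℝ} (hp : 0 ≤ p) (hq : 0 < q) :
    p * Real.exp (Real.log (q / p)) ≤ q := by
  rcases hp.eq_or_lt with rfl | hp
  · simpa using hq.le
  · rw [Real.exp_log (by positivity), mul_div_cancel₀ _ hp.ne']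

theorem mul_logRatio_add (p q : ℝ) (hq : 0 < q) (hq1 : q < 1) :
    p * logRatio p q true + (1 - p) * logRatio p q false = -klReal p q := by
  have h : ∀ a b : ℝ, b ≠ 0 → a * Real.log (b / a) = a * Real.log b - a * Real.log a := by
    intro a b hb
    rcases eq_or_ne a 0 with rfl | ha
    · simp
    · rw [Real.log_div hb ha]; ring
  simp only [logRatio, if_true, Bool.false_eq_true, if_false]
  rw [h p q hq.ne', h (1 - p) (1 - q) (by linarith), klReal]
  ring

/-- Change of measure, one round at a time. Equality can fail when `θ k` is `0` or `1`: histories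
that are impossible under `θ` but not under the new mean are lost. Only this direction is needed. -/
theorem integral_exp_rewardSum_mul_le (k : V) (q : unitInterval) (hq : 0 < (q : ℝ))
    (hq1 : (q : ℝ) < 1) (n : ℕ) (F : History V → ℝ) (hF : ∀ h, 0 ≤ F h) :
    ∫ x, Real.exp (rewardSum (logRatio (θ k) q) k (play π x n)) * F (play π x n) ∂(rewardLaw θ)
      ≤ ∫ x, F (play π x n) ∂(rewardLaw (Function.update θ k q)) := by
  induction n generalizing F with
  | zero => simp [play, rewardSum]
  | succ n ih =>
    rw [integral_play_succ (Function.update θ k q),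
      integral_play_succ θ π fun h => Real.exp (rewardSum (logRatio (θ k) q) k h) * F h]
    refine le_trans (integral_play_mono θ π (G := fun h =>
      Real.exp (rewardSum (logRatio (θ k) q) k h) * nextMean (Function.update θ k q) π F h)
      (fun h => ?_) n) (ih (nextMean (Function.update θ k q) π F) fun h => ?_)
    · have hθ0 := (θ k).2.1
      have hθ1 := (θ k).2.2
      simp only [nextMean, rewardSum]
      by_cases hk : π h = k
      · have h1 := mul_exp_log_div_le hθ0 hq
        have h2 := mul_exp_log_div_le (sub_nonneg.2 hθ1) (sub_pos.2 hq1)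
        simp only [hk, if_true, Function.update_self, logRatio, Bool.false_eq_true, if_false,
          Real.exp_add]
        have h3 := mul_le_mul_of_nonneg_right h1 (hF ((k, true) :: h))
        have h4 := mul_le_mul_of_nonneg_right h2 (hF ((k, false) :: h))
        have h5 := mul_le_mul_of_nonneg_left (add_le_add h3 h4)
          (Real.exp_pos (rewardSum (logRatio (θ k) q) k h)).le
        refine le_trans (le_of_eq ?_) h5
        ring
      · simp only [hk, if_false, zero_add, Function.update_of_ne (Ne.intro hk)]
        apply le_of_eq; ring
    · have h0 := (Function.update θ k q (π h)).2.1
      have h1 := (Function.update θ k q (π h)).2.2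
      exact add_nonneg (mul_nonneg h0 (hF _)) (mul_nonneg (sub_nonneg.2 h1) (hF _))

theorem neg_integral_rewardSum_le (k : V) {q : ℝ} (hq : 0 < q) (hq1 : q < 1) (n : ℕ) :
    -∫ x, rewardSum (logRatio (θ k) q) k (play π x n) ∂(rewardLaw θ)
      ≤ klReal (θ k) q * meanPulls θ π k n := by
  have h := integral_play_le_of_nextMean_le θ π
    (F := fun h => -rewardSum (logRatio (θ k) q) k h + -(klReal (θ k) q * pulls k h)) (fun h => by
      have e := mul_logRatio_add (θ k) q hq hq1
      simp only [nextMean, rewardSum, pulls_cons]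
      by_cases hk : π h = k
      · simp only [hk, if_true]
        push_cast
        nlinarith
      · simp only [hk, if_false, zero_add, add_zero]
        apply le_of_eq; ring) n
  rw [integral_add (integrable_comp_play θ π (fun h => -rewardSum (logRatio (θ k) q) k h) n)
    (integrable_comp_play θ π (fun h => -(klReal (θ k) q * pulls k h)) n), integral_neg,
    integral_neg, integral_const_mul] at h
  simp only [rewardSum, pulls, List.countP_nil, Nat.cast_zero, mul_zero, neg_zero, add_zero] at h
  unfold meanPulls pulls
  linarith

/-- A change of measure inequality: a functional that is exponentially integrable after a change
of the mean of arm `k` can only be large if `k` is selected often. -/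
theorem integral_le_log_two_add (k : V) (q : unitInterval) (hq : 0 < (q : ℝ))
    (hq1 : (q : ℝ) < 1) (n : ℕ) (F : History V → ℝ)
    (hF : ∫ x, Real.exp (F (play π x n)) ∂(rewardLaw (Function.update θ k q)) ≤ 2) :
    ∫ x, F (play π x n) ∂(rewardLaw θ) ≤ Real.log 2 + klReal (θ k) q * meanPulls θ π k n := by
  have h1 := integral_exp_rewardSum_mul_le θ π k q hq hq1 n (fun h => Real.exp (F h))
    fun h => (Real.exp_pos _).le
  have h2 := neg_integral_rewardSum_le θ π k hq hq1 n
  -- The tangent of `exp` at `log 2`, applied to the log-likelihood ratio plus `F`. The exponential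
  -- has mean at most `2`, so the right side integrates to at most `log 2`; this plays the role of
  -- Jensen's inequality.
  have h3 : ∀ y : ℝ, y ≤ Real.log 2 - 1 + 2⁻¹ * Real.exp y := by
    intro y
    have h4 := Real.add_one_le_exp (y - Real.log 2)
    rw [Real.exp_sub, Real.exp_log two_pos] at h4
    linarith
  have h4 := integral_play_mono θ π (fun h => h3 (rewardSum (logRatio (θ k) q) k h + F h)) n
  rw [integral_add (integrable_comp_play θ π (rewardSum (logRatio (θ k) q) k) n)
    (integrable_comp_play θ π F n),
    integral_const_add ((integrable_comp_play θ π
      (fun h => Real.exp (rewardSum (logRatio (θ k) q) k h + F h)) n).const_mul _),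
    integral_const_mul] at h4
  simp_rw [Real.exp_add] at h4
  linarith

theorem one_sub_mul_le_log_two_add (k : V) (q : unitInterval) (hq : 0 < (q : ℝ))
    (hq1 : (q : ℝ) < 1) {T : ℕ} (hT : 0 < T) {a : ℝ}
    (ha : Real.exp a * (1 - meanPulls (Function.update θ k q) π k T / T) ≤ 1) :
    (1 - meanPulls θ π k T / T) * a
      ≤ Real.log 2 + klReal (θ k) q * meanPulls θ π k T := by
  have hT' : (0 : ℝ) < T := by exact_mod_cast hT
  have hint : ∀ θ' : V → unitInterval, Integrable
      (fun x => (pulls k (play π x T) : ℝ) / T) (rewardLaw θ') := fun θ' =>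
    integrable_comp_play θ' π (fun h => (pulls k h : ℝ) / T) T
  have hmean : ∀ θ' : V → unitInterval, ∫ x, (1 - (pulls k (play π x T) : ℝ) / T) ∂(rewardLaw θ')
      = 1 - meanPulls θ' π k T / T := by
    intro θ'
    rw [integral_sub (integrable_const _) (hint θ'), integral_div]
    simp [meanPulls]
  have h := integral_le_log_two_add θ π k q hq hq1 T (fun h => (1 - (pulls k h : ℝ) / T) * a) ?_
  · rwa [integral_mul_const, hmean] at h
  · have hle : ∀ x : V × ℕ → Bool, Real.exp ((1 - (pulls k (play π x T) : ℝ) / T) * a)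
        ≤ 1 + (1 - (pulls k (play π x T) : ℝ) / T) * Real.exp a := by
      intro x
      have hz1 : (pulls k (play π x T) : ℝ) / T ≤ 1 :=
        div_le_one_of_le₀ (by exact_mod_cast pulls_play_le π x k T) hT'.le
      have hz0 : 0 ≤ (pulls k (play π x T) : ℝ) / T := by positivity
      set z := (pulls k (play π x T) : ℝ) / T
      -- The exponent is a convex combination of `0` and `a`, so its exponential is bounded linearly
      -- in `z`, and only the mean of `pulls` under the new parameter matters.
      have h1 := convexOn_exp.2 (Set.mem_univ 0) (Set.mem_univ a) hz0 (sub_nonneg.2 hz1) (by ring)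
      simp only [smul_eq_mul, mul_zero, zero_add, Real.exp_zero, mul_one] at h1
      linarith
    have hint' : Integrable (fun x => (1 - (pulls k (play π x T) : ℝ) / T) * Real.exp a)
        (rewardLaw (Function.update θ k q)) := ((integrable_const 1).sub (hint _)).mul_const _
    refine (integral_mono (integrable_comp_play _ π
      (fun h => Real.exp ((1 - (pulls k h : ℝ) / T) * a)) T)
      ((integrable_const _).add hint') hle).trans ?_
    simp only [Pi.add_apply]
    rw [integral_const_add hint', integral_mul_const, hmean]
    linarith

theorem bestMean_eq {kstar : V} (h : ∀ k, k ≠ kstar → θ k < θ kstar) :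
    bestMean θ = θ kstar := by
  have : Nonempty V := ⟨kstar⟩
  refine le_antisymm (ciSup_le fun k => ?_) (le_ciSup (f := fun k => (θ k : ℝ))
    ⟨1, by rintro _ ⟨k, rfl⟩; exact (θ k).2.2⟩ kstar)
  rcases eq_or_ne k kstar with rfl | hk
  · exact le_rfl
  · exact (h k hk).le

theorem regret_eq (T : ℕ) : regret θ π T = ∑ k, (bestMean θ - θ k) * meanPulls θ π k T := rfl

theorem sub_nonneg_of_best {kstar : V} (h : ∀ k, k ≠ kstar → θ k < θ kstar) (k : V) :
    (0 : ℝ) ≤ θ kstar - θ k := by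
  rcases eq_or_ne k kstar with rfl | hk
  · simp
  · exact sub_nonneg.2 (h k hk).le

theorem mul_meanPulls_le_regret {kstar : V} (h : ∀ k, k ≠ kstar → θ k < θ kstar) (k : V) (T : ℕ) :
    (θ kstar - θ k) * meanPulls θ π k T ≤ regret θ π T := by
  rw [regret_eq, bestMean_eq θ h]
  exact Finset.single_le_sum (f := fun k => ((θ kstar : ℝ) - θ k) * meanPulls θ π k T)
    (fun j _ => mul_nonneg (sub_nonneg_of_best θ h j) (meanPulls_nonneg θ j T)) (Finset.mem_univ k)

theorem mul_sub_meanPulls_le_regret {kstar : V} (h : ∀ k, k ≠ kstar → θ k < θ kstar) {d : ℝ}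
    (hd : ∀ k, k ≠ kstar → d ≤ (θ kstar - θ k : ℝ)) (T : ℕ) :
    d * (T - meanPulls θ π kstar T) ≤ regret θ π T := by
  rw [regret_eq, bestMean_eq θ h, ← sum_meanPulls θ π T,
    ← Finset.add_sum_erase _ _ (Finset.mem_univ kstar), add_sub_cancel_left,
    ← Finset.add_sum_erase (a := kstar) _ _ (Finset.mem_univ kstar), sub_self, zero_mul, zero_add,
    Finset.mul_sum]
  refine Finset.sum_le_sum fun k hk => ?_
  exact mul_le_mul_of_nonneg_right (hd k (Finset.ne_of_mem_erase hk)) (meanPulls_nonneg θ k T)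

/-- An increasing path to `kstar` either meets `k`, where it is cut, or is prolonged by the edge
from `kstar` to `k`. Adjacency is essential, which is why only neighbours contribute to the
constant. -/
theorem update_mem_unimodalParams {G : SimpleGraph V} {k kstar : V}
    (h : ∀ k, k ≠ kstar → θ k < θ kstar)
    (hpath : ∀ k, k ≠ kstar → Relation.ReflTransGen (fun i j => G.Adj i j ∧ θ i < θ j) k kstar)
    (hadj : G.Adj k kstar) {q : unitInterval} (hq : θ kstar < q) :
    (∀ j, j ≠ k → Function.update θ k q j < Function.update θ k q k) ∧
      Function.update θ k q ∈ unimodalParams G := by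
  have hlt : ∀ j, θ j < q := fun j => by
    rcases eq_or_ne j kstar with rfl | hj
    · exact hq
    · exact (h j hj).trans hq
  have hbest : ∀ j, j ≠ k → Function.update θ k q j < Function.update θ k q k := by
    intro j hj
    rw [Function.update_self, Function.update_of_ne hj]
    exact hlt j
  refine ⟨hbest, k, hbest, fun j hj => ?_⟩
  have h1 : Relation.ReflTransGen (fun i j => G.Adj i j ∧ θ i < θ j) j kstar := by
    rcases eq_or_ne j kstar with rfl | hj'
    · exact Relation.ReflTransGen.refl
    · exact hpath j hj'
  induction h1 using Relation.ReflTransGen.head_induction_on with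
  | refl => exact Relation.ReflTransGen.single ⟨hadj.symm, hbest _ hj⟩
  | head hac _ ih =>
    rename_i a b _
    by_cases hb : b = k
    · subst hb
      exact Relation.ReflTransGen.single ⟨hac.1, hbest _ hj⟩
    · refine Relation.ReflTransGen.head ⟨hac.1, ?_⟩ (ih hb)
      rw [Function.update_of_ne hj, Function.update_of_ne hb]
      exact hac.2

theorem eventually_mul_log_le_meanPulls {G : SimpleGraph V} (hgood : UniformlyGood G π)
    {k kstar : V} (h : ∀ k, k ≠ kstar → θ k < θ kstar)
    (hpath : ∀ k, k ≠ kstar → Relation.ReflTransGen (fun i j => G.Adj i j ∧ θ i < θ j) k kstar)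
    (hadj : G.Adj k kstar) {q : unitInterval} (hq : θ kstar < q) (hq1 : (q : ℝ) < 1) {u : ℝ}
    (hu : u * klReal (θ k) q < 1) :
    ∀ᶠ T : ℕ in atTop, u * Real.log T ≤ meanPulls θ π k T := by
  obtain ⟨hbest, hmem⟩ := update_mem_unimodalParams θ h hpath hadj hq
  set θ' := Function.update θ k q with hθ'
  have hkk := h k hadj.ne
  have hkk' : (θ k : ℝ) < θ kstar := hkk
  have hsq : (θ kstar : ℝ) < q := hq
  have hk0 : (0 : ℝ) ≤ θ k := (θ k).2.1
  have hq0 : (0 : ℝ) < q := by linarith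
  have hkl : 0 < klReal (θ k) q := klReal_pos hk0 (by linarith) hq0 hq1 (by linarith)
  -- One factor `1 - η` comes from the exponent `a = (1 - η) * log T`, where regret at most of order
  -- `T ^ η` under the new parameter is used; the other from `meanPulls θ π k T ≤ η * T` under `θ`.
  obtain ⟨η, hη0, hη1, hη⟩ : ∃ η : ℝ, 0 < η ∧ η < 1 ∧ u * klReal (θ k) q < (1 - η) * (1 - η) := by
    have hc : Tendsto (fun η : ℝ => (1 - η) * (1 - η)) (𝓝[>] 0) (𝓝 ((1 - 0) * (1 - 0))) :=
      Tendsto.mono_left (Continuous.tendsto (by fun_prop) 0) nhdsWithin_le_nhds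
    have h1 := hc.eventually_const_lt (show u * klReal (θ k) q < (1 - 0) * (1 - 0) by simpa)
    have h2 : ∀ᶠ η : ℝ in 𝓝[>] 0, η ∈ Set.Ioo (0 : ℝ) 1 := Ioo_mem_nhdsGT one_pos
    obtain ⟨η, h3, h4⟩ := (h1.and h2).exists
    exact ⟨η, h4.1, h4.2, h3⟩
  set d : ℝ := q - θ kstar with hd
  have hd0 : 0 < d := sub_pos.2 hsq
  have hgap : ∀ j, j ≠ k → d ≤ (θ' k - θ' j : ℝ) := by
    intro j hj
    have : (θ j : ℝ) ≤ θ kstar := by linarith [sub_nonneg_of_best θ h j]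
    rw [hθ', Function.update_self, Function.update_of_ne hj]
    linarith
  have hlog := (Real.tendsto_log_atTop.comp tendsto_natCast_atTop_atTop).eventually_ge_atTop
    (Real.log 2 / ((1 - η) * (1 - η) - u * klReal (θ k) q))
  have e1 := (hgood θ' hmem η hη0).def hd0
  have e2 := (hgood θ ⟨kstar, h, hpath⟩ 1 one_pos).def (mul_pos (sub_pos.2 hkk') hη0)
  filter_upwards [e1, e2, hlog, eventually_ge_atTop 1] with T h1 h2 h3 hT
  have hT0 : (0 : ℝ) < T := by exact_mod_cast hT
  have hlogT : 0 ≤ Real.log T := Real.log_natCast_nonneg T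
  rw [Real.norm_of_nonneg (Real.rpow_nonneg hT0.le _)] at h1
  rw [Real.rpow_one, Real.norm_of_nonneg hT0.le] at h2
  have h4 : (T : ℝ) - meanPulls θ' π k T ≤ (T : ℝ) ^ η := by
    have := (mul_sub_meanPulls_le_regret θ' π hbest hgap T).trans ((le_abs_self _).trans h1)
    exact le_of_mul_le_mul_left this hd0
  have h5 : meanPulls θ π k T ≤ η * T := by
    have := (mul_meanPulls_le_regret θ π h k T).trans ((le_abs_self _).trans h2)
    rw [mul_assoc] at this
    exact le_of_mul_le_mul_left this (sub_pos.2 hkk')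
  have h6 := one_sub_mul_le_log_two_add θ π k q hq0 hq1 hT (a := (1 - η) * Real.log T) (by
    rw [← hθ', mul_comm (1 - η), ← Real.rpow_def_of_pos hT0, one_sub_div hT0.ne']
    calc (T : ℝ) ^ (1 - η) * ((T - meanPulls θ' π k T) / T)
        ≤ (T : ℝ) ^ (1 - η) * ((T : ℝ) ^ η / T) := by gcongr
      _ = 1 := by
        rw [← mul_div_assoc, ← Real.rpow_add hT0]; simp [hT0.ne'])
  have h7 : meanPulls θ π k T / T ≤ η := by rwa [div_le_iff₀ hT0]
  have h8 : (1 - η) * ((1 - η) * Real.log T)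
      ≤ (1 - meanPulls θ π k T / T) * ((1 - η) * Real.log T) := by
    refine mul_le_mul_of_nonneg_right (by linarith) (mul_nonneg (by linarith) hlogT)
  rw [div_le_iff₀ (by linarith)] at h3
  simp only [Function.comp] at h3
  have h9 : klReal (θ k) q * (u * Real.log T) ≤ klReal (θ k) q * meanPulls θ π k T := by linarith
  exact le_of_mul_le_mul_left h9 hkl

end LowerBound

/-! ### Asymptotic optimality -/

section Optimality

open Asymptotics

variable {V : Type*} [Fintype V] [DecidableEq V] (θ : V → unitInterval) {π : Policy V}

/-- For `r = 1` the term `-(1 - (p + δ)) * log δ` blows up, so the inverse tends to `0`. This is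
also `⊤.toReal⁻¹`, in agreement with the convention that terms with infinite divergence vanish. -/
theorem tendsto_inv_klReal {p r : ℝ} (hp : 0 ≤ p) (hpr : p < r) (hr : r ≤ 1) :
    Tendsto (fun δ : ℝ => (klReal (p + δ) (r - δ))⁻¹) (𝓝[>] 0) (𝓝 (klBer p r).toReal⁻¹) := by
  have hr0 : 0 < r := hp.trans_lt hpr
  rcases hr.eq_or_lt with rfl | hr1
  · rw [klBer_one hpr.ne, ENNReal.toReal_top, inv_zero]
    refine Tendsto.inv_tendsto_atTop ?_
    have h1 : Tendsto (fun δ : ℝ => (p + δ) * Real.log (p + δ)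
        + (1 - (p + δ)) * Real.log (1 - (p + δ)) - (p + δ) * Real.log (1 - δ)) (𝓝[>] 0)
        (𝓝 (p * Real.log p + (1 - p) * Real.log (1 - p) - p * Real.log 1)) := by
      have c1 : Continuous fun δ : ℝ => (p + δ) * Real.log (p + δ)
          + (1 - (p + δ)) * Real.log (1 - (p + δ)) :=
        (Real.continuous_mul_log.comp (by fun_prop : Continuous fun δ : ℝ => p + δ)).add
          (Real.continuous_mul_log.comp (by fun_prop : Continuous fun δ : ℝ => 1 - (p + δ)))
      have c2 : ContinuousAt (fun δ : ℝ => (p + δ) * Real.log (1 - δ)) 0 :=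
        ContinuousAt.mul (by fun_prop) (ContinuousAt.log (by fun_prop) (by simp))
      have := (c1.continuousAt.sub c2).tendsto.mono_left (nhdsWithin_le_nhds (s := Set.Ioi 0))
      simpa [Pi.sub_def] using this
    have h2 : Tendsto (fun δ : ℝ => -((1 - (p + δ)) * Real.log δ)) (𝓝[>] 0) atTop := by
      have h3 : Tendsto (fun δ : ℝ => 1 - (p + δ)) (𝓝[>] 0) (𝓝 (1 - p)) := by
        have : Continuous fun δ : ℝ => 1 - (p + δ) := by fun_prop
        simpa using (this.tendsto 0).mono_left (nhdsWithin_le_nhds (s := Set.Ioi 0))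
      exact tendsto_neg_atBot_atTop.comp
        (h3.pos_mul_atBot (by linarith) Real.tendsto_log_nhdsGT_zero)
    refine (h1.add_atTop h2).congr fun δ => ?_
    rw [klReal]; ring_nf
  · rw [klBer_eq hr0 hr1, ENNReal.toReal_ofReal (klReal_nonneg hp (by linarith) hr0 hr1)]
    have c1 : Continuous fun δ : ℝ => (p + δ) * Real.log (p + δ)
        + (1 - (p + δ)) * Real.log (1 - (p + δ)) :=
      (Real.continuous_mul_log.comp (by fun_prop : Continuous fun δ : ℝ => p + δ)).add
        (Real.continuous_mul_log.comp (by fun_prop : Continuous fun δ : ℝ => 1 - (p + δ)))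
    have c2 : ContinuousAt (fun δ : ℝ => (p + δ) * Real.log (r - δ)) 0 :=
      ContinuousAt.mul (by fun_prop) (ContinuousAt.log (by fun_prop) (by simpa using hr0.ne'))
    have c3 : ContinuousAt (fun δ : ℝ => (1 - (p + δ)) * Real.log (1 - (r - δ))) 0 :=
      ContinuousAt.mul (by fun_prop) (ContinuousAt.log (by fun_prop) (by
        simp only [sub_zero]; linarith))
    have h := ((c1.continuousAt.sub c2).sub c3).tendsto.mono_left
      (nhdsWithin_le_nhds (s := Set.Ioi 0))
    refine Tendsto.inv₀ ?_ (klReal_pos hp (by linarith) hr0 hr1 hpr.ne).ne'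
    simpa [klReal, Pi.sub_def] using h

/-- The asymptotic frequency, relative to `log T`, of the selections of arm `k` under an optimal
rule if the best arm is `kstar`. -/
def pullRate (G : SimpleGraph V) [DecidableRel G.Adj] (kstar k : V) : ℝ :=
  if G.Adj k kstar then (klBer (θ k) (θ kstar)).toReal⁻¹ else 0

variable {G : SimpleGraph V} [DecidableRel G.Adj]

theorem IsLeaderRule.eventually_meanPulls_le {c : ℝ} (hc : 0 < c) {Λ : History V → V}
    (hΛ : IsLeaderRule π G c Λ) {kstar : V} (h : ∀ k, k ≠ kstar → θ k < θ kstar)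
    (hpath : ∀ k, k ≠ kstar → Relation.ReflTransGen (fun i j => G.Adj i j ∧ θ i < θ j) k kstar)
    {k : V} (hk : k ≠ kstar) {u : ℝ} (hu : pullRate θ G kstar k < u) :
    ∀ᶠ T : ℕ in atTop, meanPulls θ π k T ≤ u * Real.log T := by
  have hled : ∀ j ≠ kstar, (fun T : ℕ => ∫ x, (ledRounds π Λ x j T : ℝ) ∂(rewardLaw θ))
      =o[atTop] fun T : ℕ => Real.log T := by
    intro j hj
    rcases Relation.ReflTransGen.cases_head (hpath j hj) with e | ⟨i, ⟨hadj, hlt⟩, -⟩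
    · exact absurd e hj
    · exact hΛ.integral_ledRounds_isLittleO θ hc hadj.symm hlt
  by_cases hadj : G.Adj k kstar
  · rw [pullRate, if_pos hadj] at hu
    have hlt : (θ k : ℝ) < θ kstar := h k hk
    obtain ⟨v, hv, hvu⟩ := exists_between hu
    have hv0 : 0 ≤ v := (inv_nonneg.2 ENNReal.toReal_nonneg).trans hv.le
    obtain ⟨δ, h1, h2⟩ := (((tendsto_inv_klReal (θ k).2.1 hlt (θ kstar).2.2).eventually_lt_const
      hv).and (Ioo_mem_nhdsGT (show (0 : ℝ) < (θ kstar - θ k) / 2 by linarith))).exists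
    obtain ⟨r, hr, hle⟩ := hΛ.meanPulls_le_of_adj θ hc hadj h2.1 (by linarith [h2.2]) hled
    have ho : (fun T : ℕ => v * |budget c T - Real.log T| + r T) =o[atTop]
        fun T : ℕ => Real.log T :=
      ((budget_isLittleO c).abs_left.const_mul_left v).add hr
    filter_upwards [ho.def (sub_pos.2 hvu)] with T hT
    have hlog : 0 ≤ Real.log T := Real.log_natCast_nonneg T
    rw [Real.norm_of_nonneg hlog] at hT
    have h3 := (le_abs_self _).trans hT
    have h4 : max (budget c T) 0 ≤ Real.log T + |budget c T - Real.log T| :=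
      max_le (by linarith [le_abs_self (budget c T - Real.log T)]) (by positivity)
    have h5 := hle T
    rw [div_eq_mul_inv] at h5
    have h6 : max (budget c T) 0 * (klReal (θ k + δ) (θ kstar - δ))⁻¹
        ≤ (Real.log T + |budget c T - Real.log T|) * v :=
      (mul_le_mul_of_nonneg_left h1.le (le_max_right _ _)).trans
        (mul_le_mul_of_nonneg_right h4 hv0)
    linarith
  · rw [pullRate, if_neg hadj] at hu
    filter_upwards [(hΛ.meanPulls_isLittleO_of_not_adj θ hk hadj hled).def hu] with T hT
    rw [Real.norm_of_nonneg (Real.log_natCast_nonneg T)] at hT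
    exact (le_abs_self _).trans hT

theorem UniformlyGood.eventually_le_meanPulls (hgood : UniformlyGood G π) {kstar : V}
    (h : ∀ k, k ≠ kstar → θ k < θ kstar)
    (hpath : ∀ k, k ≠ kstar → Relation.ReflTransGen (fun i j => G.Adj i j ∧ θ i < θ j) k kstar)
    {k : V} {u : ℝ} (hu : u < pullRate θ G kstar k) :
    ∀ᶠ T : ℕ in atTop, u * Real.log T ≤ meanPulls θ π k T := by
  rcases le_or_gt u 0 with hu0 | hu0
  · refine Eventually.of_forall fun T => le_trans ?_ (meanPulls_nonneg θ k T)
    exact mul_nonpos_of_nonpos_of_nonneg hu0 (Real.log_natCast_nonneg T)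
  rw [pullRate] at hu
  split_ifs at hu with hadj
  · have hlt : (θ k : ℝ) < θ kstar := h k hadj.ne
    have hk0 : (0 : ℝ) ≤ θ k := (θ k).2.1
    have hs0 : (0 : ℝ) < θ kstar := by linarith
    rcases (θ kstar).2.2.eq_or_lt with hs1 | hs1
    -- If the best mean is `1`, no larger mean is available for the change of measure, but the rate
    -- is `0` and contradicts `0 < u`.
    · rw [hs1, klBer_one (by linarith), ENNReal.toReal_top, inv_zero] at hu
      linarith
    · rw [klBer_eq hs0 hs1, ENNReal.toReal_ofReal (klReal_nonneg hk0 (by linarith) hs0 hs1),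
        ← one_div, lt_div_iff₀ (klReal_pos hk0 (by linarith) hs0 hs1 hlt.ne)] at hu
      have hc : ContinuousAt (fun q : ℝ => u * klReal (θ k) q) (θ kstar) := by
        have h1 : ContinuousAt (fun q : ℝ => Real.log q) (θ kstar) :=
          Real.continuousAt_log hs0.ne'
        have h2 : ContinuousAt (fun q : ℝ => Real.log (1 - q)) (θ kstar) :=
          ContinuousAt.log (by fun_prop) (by linarith)
        unfold klReal
        fun_prop
      have h1 : ∀ᶠ q : ℝ in 𝓝[>] (θ kstar : ℝ), u * klReal (θ k) q < 1 :=
        (hc.tendsto.mono_left nhdsWithin_le_nhds).eventually_lt_const hu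
      obtain ⟨q, h2, h3⟩ := (h1.and (Ioo_mem_nhdsGT hs1)).exists
      exact eventually_mul_log_le_meanPulls θ π hgood h hpath hadj
        (q := ⟨q, by linarith [h3.1], h3.2.le⟩) h3.1 h3.2 h2
  · linarith

/-- The regret constant as a real number. -/
def regretRate (G : SimpleGraph V) [DecidableRel G.Adj] (kstar : V) : ℝ :=
  ∑ k, (θ kstar - θ k) * pullRate θ G kstar k

theorem regretConst_eq {kstar : V} (h : ∀ k, k ≠ kstar → θ k < θ kstar) :
    regretConst G θ = ENNReal.ofReal (regretRate θ G kstar) := by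
  classical
  have hnn : ∀ k, 0 ≤ pullRate θ G kstar k := fun k => by
    rw [pullRate]; split_ifs
    · exact inv_nonneg.2 ENNReal.toReal_nonneg
    · exact le_rfl
  rw [regretConst, regretRate, ENNReal.ofReal_sum_of_nonneg fun k _ =>
    mul_nonneg (sub_nonneg_of_best θ h k) (hnn k), Finset.sum_filter]
  refine Finset.sum_congr rfl fun k _ => ?_
  have hiff : (∃ kstar', (∀ j, θ j ≤ θ kstar') ∧ G.Adj k kstar') ↔ G.Adj k kstar := by
    constructor
    · rintro ⟨k', h1, h2⟩
      rcases eq_or_ne k' kstar with rfl | hne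
      · exact h2
      · exact absurd (h1 kstar) (not_le.2 (h k' hne))
    · intro hadj
      refine ⟨kstar, fun j => ?_, hadj⟩
      have h1 := sub_nonneg_of_best θ h j
      exact Subtype.coe_le_coe.1 (by linarith)
  simp only [hiff, pullRate]
  split_ifs with hadj
  · rw [bestMean_eq θ h, ENNReal.ofReal_mul (sub_nonneg_of_best θ h k), div_eq_mul_inv]
    congr 1
    have hlt : (θ k : ℝ) < θ kstar := h k hadj.ne
    have hk0 : (0 : ℝ) ≤ θ k := (θ k).2.1
    rcases (θ kstar).2.2.eq_or_lt with hs1 | hs1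
    · rw [hs1, klBer_one (by linarith)]; simp
    · have hpos := klReal_pos hk0 (by linarith) (by linarith) hs1 hlt.ne
      rw [klBer_eq (by linarith) hs1, ENNReal.toReal_ofReal hpos.le, ENNReal.ofReal_inv_of_pos hpos]
  · simp

theorem regretRate_nonneg {kstar : V} (h : ∀ k, k ≠ kstar → θ k < θ kstar) :
    0 ≤ regretRate θ G kstar := by
  refine Finset.sum_nonneg fun k _ => mul_nonneg (sub_nonneg_of_best θ h k) ?_
  rw [pullRate]; split_ifs
  · exact inv_nonneg.2 ENNReal.toReal_nonneg
  · exact le_rfl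

theorem exists_pos_regretRate_add {kstar : V} (h : ∀ k, k ≠ kstar → θ k < θ kstar) {d : ℝ}
    (hd : 0 < d) : ∃ ε > 0, ε * ∑ k, ((θ kstar : ℝ) - θ k) ≤ d := by
  have h0 : 0 ≤ ∑ k, ((θ kstar : ℝ) - θ k) := Finset.sum_nonneg fun k _ =>
    sub_nonneg_of_best θ h k
  -- The summand `1` keeps the denominator positive when there is only one arm.
  refine ⟨d / (1 + ∑ k, ((θ kstar : ℝ) - θ k)), by positivity, ?_⟩
  rw [div_mul_eq_mul_div, div_le_iff₀ (by positivity)]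
  nlinarith

theorem IsLeaderRule.eventually_regret_le {c : ℝ} (hc : 0 < c) {Λ : History V → V}
    (hΛ : IsLeaderRule π G c Λ) {kstar : V} (h : ∀ k, k ≠ kstar → θ k < θ kstar)
    (hpath : ∀ k, k ≠ kstar → Relation.ReflTransGen (fun i j => G.Adj i j ∧ θ i < θ j) k kstar)
    {M : ℝ} (hM : regretRate θ G kstar < M) :
    ∀ᶠ T : ℕ in atTop, regret θ π T ≤ M * Real.log T := by
  obtain ⟨ε, hε, hle⟩ := exists_pos_regretRate_add θ h (sub_pos.2 hM)
  have hall : ∀ᶠ T : ℕ in atTop, ∀ k, k ≠ kstar →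
      meanPulls θ π k T ≤ (pullRate θ G kstar k + ε) * Real.log T := by
    refine eventually_all.2 fun k => ?_
    by_cases hk : k = kstar
    · exact Eventually.of_forall fun T h' => absurd hk h'
    · filter_upwards [hΛ.eventually_meanPulls_le θ hc h hpath hk (lt_add_of_pos_right _ hε)]
        with T hT _ using hT
  filter_upwards [hall] with T hT
  have h1 : regret θ π T ≤ ∑ k, (θ kstar - θ k) * ((pullRate θ G kstar k + ε) * Real.log T) := by
    rw [regret_eq, bestMean_eq θ h]
    refine Finset.sum_le_sum fun k _ => ?_
    rcases eq_or_ne k kstar with rfl | hk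
    · simp
    · exact mul_le_mul_of_nonneg_left (hT k hk) (sub_nonneg_of_best θ h k)
  have h2 : ∑ k, ((θ kstar : ℝ) - θ k) * ((pullRate θ G kstar k + ε) * Real.log T)
      = (regretRate θ G kstar + ε * ∑ k, ((θ kstar : ℝ) - θ k)) * Real.log T := by
    rw [regretRate, Finset.mul_sum, ← Finset.sum_add_distrib, Finset.sum_mul]
    exact Finset.sum_congr rfl fun k _ => by ring
  refine (h1.trans_eq h2).trans (mul_le_mul_of_nonneg_right (by linarith)
    (Real.log_natCast_nonneg T))

theorem UniformlyGood.eventually_le_regret (hgood : UniformlyGood G π) {kstar : V}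
    (h : ∀ k, k ≠ kstar → θ k < θ kstar)
    (hpath : ∀ k, k ≠ kstar → Relation.ReflTransGen (fun i j => G.Adj i j ∧ θ i < θ j) k kstar)
    {M : ℝ} (hM : M < regretRate θ G kstar) :
    ∀ᶠ T : ℕ in atTop, M * Real.log T ≤ regret θ π T := by
  obtain ⟨ε, hε, hle⟩ := exists_pos_regretRate_add θ h (sub_pos.2 hM)
  have hall : ∀ᶠ T : ℕ in atTop, ∀ k,
      (pullRate θ G kstar k - ε) * Real.log T ≤ meanPulls θ π k T :=
    eventually_all.2 fun k => hgood.eventually_le_meanPulls θ h hpath (sub_lt_self _ hε)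
  filter_upwards [hall] with T hT
  have h1 : ∑ k, (θ kstar - θ k) * ((pullRate θ G kstar k - ε) * Real.log T) ≤ regret θ π T := by
    rw [regret_eq, bestMean_eq θ h]
    exact Finset.sum_le_sum fun k _ =>
      mul_le_mul_of_nonneg_left (hT k) (sub_nonneg_of_best θ h k)
  have h2 : ∑ k, ((θ kstar : ℝ) - θ k) * ((pullRate θ G kstar k - ε) * Real.log T)
      = (regretRate θ G kstar - ε * ∑ k, ((θ kstar : ℝ) - θ k)) * Real.log T := by
    rw [regretRate, Finset.mul_sum, ← Finset.sum_sub_distrib, Finset.sum_mul]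
    exact Finset.sum_congr rfl fun k _ => by ring
  refine le_trans (mul_le_mul_of_nonneg_right (by linarith)
    (Real.log_natCast_nonneg T)) (h2.symm.trans_le h1)

theorem regret_nonneg {kstar : V} (h : ∀ k, k ≠ kstar → θ k < θ kstar) (T : ℕ) :
    0 ≤ regret θ π T := by
  rw [regret_eq, bestMean_eq θ h]
  exact Finset.sum_nonneg fun k _ =>
    mul_nonneg (sub_nonneg_of_best θ h k) (meanPulls_nonneg θ k T)

theorem IsLeaderRule.uniformlyGood {c : ℝ} (hc : 0 < c) {Λ : History V → V}
    (hΛ : IsLeaderRule π G c Λ) : UniformlyGood G π := by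
  rintro θ ⟨kstar, h, hpath⟩ a ha
  have hO : (fun T : ℕ => regret θ π T) =O[atTop] fun T : ℕ => Real.log T := by
    refine IsBigO.of_bound (regretRate θ G kstar + 1) ?_
    filter_upwards [hΛ.eventually_regret_le θ hc h hpath (lt_add_one _)] with T hT
    rwa [Real.norm_of_nonneg (regret_nonneg θ h T),
      Real.norm_of_nonneg (Real.log_natCast_nonneg T)]
  exact hO.trans_isLittleO ((isLittleO_log_rpow_atTop ha).comp_tendsto
    tendsto_natCast_atTop_atTop)

theorem eventually_log_natCast_pos : ∀ᶠ T : ℕ in atTop, 0 < Real.log T :=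
  (Real.tendsto_log_atTop.comp tendsto_natCast_atTop_atTop).eventually_gt_atTop 0

theorem coe_regretConst_eq {kstar : V} (h : ∀ k, k ≠ kstar → θ k < θ kstar) :
    (regretConst G θ : EReal) = ((regretRate θ G kstar : ℝ) : EReal) := by
  rw [regretConst_eq θ h, EReal.coe_ennreal_ofReal, max_eq_left (regretRate_nonneg θ h)]

theorem IsLeaderRule.limsup_le {c : ℝ} (hc : 0 < c) {Λ : History V → V}
    (hΛ : IsLeaderRule π G c Λ) (hθ : θ ∈ unimodalParams G) :
    limsup (fun T : ℕ => ((regret θ π T / Real.log T : ℝ) : EReal)) atTop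
      ≤ (regretConst G θ : EReal) := by
  obtain ⟨kstar, h, hpath⟩ := hθ
  rw [coe_regretConst_eq θ h]
  refine EReal.le_of_forall_lt_iff_le.1 fun M hM => ?_
  refine limsup_le_of_le (by isBoundedDefault) ?_
  filter_upwards [hΛ.eventually_regret_le θ hc h hpath (EReal.coe_lt_coe_iff.1 hM),
    eventually_log_natCast_pos] with T hT hlog
  rw [EReal.coe_le_coe_iff, div_le_iff₀ hlog]
  exact hT

theorem UniformlyGood.le_liminf (hgood : UniformlyGood G π) (hθ : θ ∈ unimodalParams G) :
    (regretConst G θ : EReal)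
      ≤ liminf (fun T : ℕ => ((regret θ π T / Real.log T : ℝ) : EReal)) atTop := by
  obtain ⟨kstar, h, hpath⟩ := hθ
  rw [coe_regretConst_eq θ h]
  refine EReal.ge_of_forall_gt_iff_ge.1 fun M hM => ?_
  refine le_liminf_of_le (by isBoundedDefault) ?_
  filter_upwards [hgood.eventually_le_regret θ h hpath (EReal.coe_lt_coe_iff.1 hM),
    eventually_log_natCast_pos] with T hT hlog
  rw [EReal.coe_le_coe_iff, le_div_iff₀ hlog]
  exact hT

end Optimality

end UnimodalBandit

end

open UnimodalBandit
theorem mainTheorem3 {V : Type*} [Fintype V] [DecidableEq V] (G : SimpleGraph V)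
    [DecidableRel G.Adj] (c : ℝ) (hc : 0 < c) (π : Policy V) (hπ : IsOSUB G c π) :
    (∀ θ ∈ unimodalParams G,
      limsup (fun T : ℕ => ((regret θ π T / Real.log T : ℝ) : EReal)) atTop
        ≤ (regretConst G θ : EReal)) ∧
    UniformlyGood G π ∧
    (∀ π' : Policy V, UniformlyGood G π' → ∀ θ ∈ unimodalParams G,
      (regretConst G θ : EReal)
        ≤ liminf (fun T : ℕ => ((regret θ π' T / Real.log T : ℝ) : EReal)) atTop) := by
  obtain ⟨Λ, hΛ⟩ := hπ
  have hΛ' : IsLeaderRule π G c Λ := hΛ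
  exact ⟨fun θ hθ => hΛ'.limsup_le θ hc hθ, hΛ'.uniformlyGood hc,
    fun π' hgood θ hθ => hgood.le_liminf θ hθ⟩
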